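/- **Notation.** Let $\mathbb F$ be a field and $n\ge 1$, $k\ge 2$ integers, and let $P(\lambda)=\sum_{i=0}^k A_i\lambda^i\in\mathbb F[\lambda]^{n\times n}$ be a matrix polynomial of grade $k$ (any $A_i$, also $A_k$, may be zero). All $kn\times kn$ matrices are viewed as $k\times k$ block-matrices with $n\times n$ blocks, numbered from $1$; $H^{\mathcal B}$ is the block-transpose (blocks are moved, not transposed). *Tuples.* An index tuple is a finite sequence of nonnegative integers; $\mathrm{rev}$ is reversal, and $(a:b)=(a,a+1,\dots,b)$. A tuple $\mathbf t$ satisfies the SIP if between any two equal indices $x$ of $\mathbf t$ there is an index $x+1$. Two tuples are equivalent if one is obtained from the other by finitely many interchanges of adjacent indices $x\ne y$ with $|x-y|\neq 1$. A tuple satisfying the SIP is equivalent to a unique tuple $(a_s:b_s,\dots,a_1:b_1)$ with $b_s>\dots>b_1$ and $a_i\le b_i$; put $\mathrm{heads}(\mathbf t)=\{b_1,\dots,b_s\}$ and $\mathfrak h(\mathbf t)=s$. *Elementary matrices.* For $B\in\mathbb F^{n\times n}$ let $M_0(B)=I_{(k-1)n}\oplus B$ and $M_i(B)=I_{(k-i-1)n}\oplus\begin{bmatrix}B&I_n\\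 I_n&0\end{bmatrix}\oplus I_{(i-1)n}$ for $1\le i\le k-1$. For a tuple $\mathbf t=(t_1,\dots,t_r)$ with indices in $\{0:k-1\}$ and a matrix assignment $\mathcal X=(X_1,\dots,X_r)$ (arbitrary matrices $X_i\in\mathbb F^{n\times n}$), $M_{\mathbf t}(\mathcal X)=M_{t_1}(X_1)\cdots M_{t_r}(X_r)$; moreover $M^P_{\mathbf t}=M_{t_1}(-A_{t_1})\cdots M_{t_r}(-A_{t_r})$ and $M^P_{-k}=A_k\oplus I_{(k-1)n}$. *Pencils.* A wing pencil of type $(s,n)$ is a pencil $K(\lambda)\in\mathbb F[\lambda]^{sn\times(s+1)n}$ with $K(\lambda)\,([\lambda^s,\dots,\lambda,1]^T\otimes I_n)=0$. An extended $(p,n,q,n)$-block Kronecker pencil with body $M(\lambda)$ is a pencil $\begin{bmatrix}M(\lambda)&K_2(\lambda)^T\\K_1(\lambda)&0\end{bmatrix}$ with $M(\lambda)$ a $(q+1)\times(p+1)$ block-pencil and $K_1$, $K_2$ wing pencils of types $(p,n)$ and $(q,n)$. If $p+q+1=k$, the body $M(\lambda)=\lambda M_1+M_0$ satisfies the AS condition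 for $P(\lambda)$ if $\sum_{i+j=k+2-s}[M_1]_{ij}+\sum_{i+j=k+1-s}[M_0]_{ij}=A_s$ for $s=0,\dots,k$. For a permutation $\mathbf c$ of $\{1:k\}$, $\Pi^n_{\mathbf c}$ has $I_n$ in block-positions $(c_i,i)$ and zero blocks elsewhere. **Theorem.** Let $\mathbf q$ be a permutation of $\{0:k-1\}$, let $\boldsymbol\ell_q,\mathbf r_q$ be tuples with indices in $\{0:k-2\}$ such that $(\boldsymbol\ell_q,\mathbf q,\mathbf r_q)$ satisfies the SIP, let $\mathcal X,\mathcal Y$ be matrix assignments for $\boldsymbol\ell_q,\mathbf r_q$, and let $$L_P(\lambda)=M_{\boldsymbol\ell_q}(\mathcal X)\,(\lambda M^P_{-k}-M^P_{\mathbf q})\,M_{\mathbf r_q}(\mathcal Y).$$ Put $p=\mathfrak h(\mathbf q)-1$ and $q=\mathfrak h(\mathrm{rev}(\mathbf q))-1$. Then there are permutations $\boldsymbol\ell,\mathbf r$ of $\{1:k\}$ such that $(\Pi^n_{\boldsymbol\ell})^{\mathcal B}L_P(\lambda)\Pi^n_{\mathbf r}$ is an extended $(p,n,q,n)$-block Kronecker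 pencil (so $p+q+1=k$) whose body $M(\lambda)$ satisfies the AS condition for $P(\lambda)$. Call $r_i$ with $i>p+1$ the positions of the wing block-columns, and $\ell_i$ with $i>q+1$ the positions of the wing block-rows. Then $\boldsymbol\ell,\mathbf r$ can moreover be chosen so that all of the following hold. (a) $\ell_1=r_1=1$, i.e. the first block-row and block-column of $L_P(\lambda)$ are its first body block-row and body block-column; and the block of $M(\lambda)$ in position $(1,1)$ is $\lambda A_k+A_{k-1}$. (b) For each $j\in\{0:k-2\}$ with $j\notin\mathrm{heads}(\boldsymbol\ell_q,\mathbf q,\mathbf r_q)$, the block-column of $(\Pi^n_{\boldsymbol\ell})^{\mathcal B}L_P(\lambda)$ in position $k-j$ is a wing block-column of the form $-e_i\otimes I_n+\lambda e_{i+1}\otimes I_n$ with $1\le i\le q$. These are precisely the wing block-columns of this form for generic $\mathcal Y$, namely whenever no matrix of $\mathcal Y$ is $0$ and none of those assigned to the index $0$ is $I_n$. For $j\in\{0:k-2\}$, $j\notin\mathrm{heads}(\boldsymbol\ell_q,\mathbf q,\mathbf r_q)$ if and only if $(\boldsymbol\ell_q,\mathbf q,\mathbf r_q,j)$ satisfies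 the SIP. (c) Let $\mathbf u=(\mathrm{rev}(\mathbf r_q),\mathrm{rev}(\mathbf q),\mathrm{rev}(\boldsymbol\ell_q))$. For each $j\in\{0:k-2\}$ with $j\notin\mathrm{heads}(\mathbf u)$, the block-row of $L_P(\lambda)\Pi^n_{\mathbf r}$ in position $k-j$ is a wing block-row of the form $-e_i^T\otimes I_n+\lambda e_{i+1}^T\otimes I_n$ with $1\le i\le p$. These are precisely the wing block-rows of this form for generic $\mathcal X$, namely whenever no matrix of $\mathcal X$ is $0$ and none of those assigned to the index $0$ is $I_n$. For $j\in\{0:k-2\}$, $j\notin\mathrm{heads}(\mathbf u)$ if and only if $(\mathbf u,j)$ satisfies the SIP. -/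

import Mathlib

open Polynomial

namespace GFPR

/-! ### Index tuples of nonnegative integers -/

/-- The Successor Infix Property: between any two equal indices `x` of the tuple there is
an index equal to `x + 1`. -/
def SIP (t : List ℕ) : Prop :=
  ∀ a b : Fin t.length, a < b → t.get a = t.get b →
    ∃ c : Fin t.length, a < c ∧ c < b ∧ t.get c = t.get a + 1

/-- Interchange of two distinct commuting indices (i.e. with difference different from `±1`)
in adjacent positions. -/
def CommStep (t t' : List ℕ) : Prop :=
  ∃ (u v : List ℕ) (x y : ℕ), x ≠ y ∧ x + 1 ≠ y ∧ y + 1 ≠ x ∧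
    t = u ++ x :: y :: v ∧ t' = u ++ y :: x :: v

/-- Equivalence of index tuples: finitely many interchanges of adjacent commuting indices. -/
def TupleEquiv (t t' : List ℕ) : Prop := Relation.ReflTransGen CommStep t t'

/-- The string `(a : b) = (a, a + 1, …, b)`. -/
def string (s : ℕ × ℕ) : List ℕ := List.range' s.1 (s.2 + 1 - s.1)

/-- The tuple `(a_s : b_s, …, a_1 : b_1)` written as the list of the pairs `(a_i, b_i)` is in
column standard form: `a_i ≤ b_i` and `b_s > ⋯ > b_1`. -/
def IsColumnStandard (S : List (ℕ × ℕ)) : Prop :=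
  (∀ s ∈ S, s.1 ≤ s.2) ∧ S.Pairwise (fun s s' => s'.2 < s.2)

/-- The heads of a tuple: the right end points `b_i` of the strings of its column standard form,
i.e. of a tuple in column standard form that is equivalent to it. -/
def heads (t : List ℕ) : Set ℕ :=
  {b | ∃ S : List (ℕ × ℕ), IsColumnStandard S ∧ TupleEquiv t (S.map string).flatten ∧
    ∃ a, (a, b) ∈ S}

/-- The number `𝔥(t)` of heads of `t`. -/
noncomputable def headCount (t : List ℕ) : ℕ := (heads t).ncard

/-! ### Block-matrices and matrix polynomials

A block-matrix with blocks of size `n × n` is a matrix whose entries are `n × n` matrices.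
Multiplication is the usual one, and the block-transpose `(·)^𝓑` is `Matrix.transpose`
applied to the block-matrix (the blocks are moved, but not transposed).
-/

/-- `n × n` matrix polynomials. -/
abbrev MatPoly (F : Type*) [Field F] (n : ℕ) := Matrix (Fin n) (Fin n) F[X]

/-- `a × b` block-matrices whose blocks are `n × n` matrices over `F`. -/
abbrev BlockMat (F : Type*) (n a b : ℕ) := Matrix (Fin a) (Fin b) (Matrix (Fin n) (Fin n) F)

/-- `a × b` block-matrices whose blocks are `n × n` matrix polynomials. -/
abbrev PolyBlockMat (F : Type*) [Field F] (n a b : ℕ) := Matrix (Fin a) (Fin b) (MatPoly F n)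

section
variable {F : Type*} [Field F] {n : ℕ}

/-- A constant matrix viewed as a matrix polynomial. -/
noncomputable def constPoly (B : Matrix (Fin n) (Fin n) F) : MatPoly F n := B.map C

/-- A constant block-matrix viewed as a polynomial block-matrix. -/
noncomputable def constBlock {a b : ℕ} (B : BlockMat F n a b) : PolyBlockMat F n a b :=
  B.map constPoly

/-- The coefficient `A_i` of `λ ^ i` in the matrix polynomial `P(λ)`. -/
def matCoeff (P : MatPoly F n) (i : ℕ) : Matrix (Fin n) (Fin n) F := P.map (fun f => f.coeff i)

/-- `P(λ) = ∑_{i ≤ k} A_i λ ^ i`; any of the coefficients, `A_k` included, may vanish. -/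
def HasGrade (P : MatPoly F n) (k : ℕ) : Prop := ∀ a b, (P a b).natDegree ≤ k

/-- A matrix pencil: every block has grade `1`. -/
def IsPencil {a b : ℕ} (L : PolyBlockMat F n a b) : Prop := ∀ i j, HasGrade (L i j) 1

/-- The ordinary transpose of a matrix given by blocks. -/
def fullTranspose {a b : ℕ} (L : PolyBlockMat F n a b) : PolyBlockMat F n b a :=
  fun i j => (L j i).transpose

/-- The block-column `Λ_s(λ)ᵀ ⊗ I_n`, with blocks `λ ^ s I_n, …, λ I_n, I_n`. -/
noncomputable def lambdaCol (F : Type*) [Field F] (n s : ℕ) : PolyBlockMat F n (s + 1) 1 :=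
  fun j _ => (X ^ (s - (j : ℕ)) : F[X]) • (1 : MatPoly F n)

/-- `(s, n)`-wing pencils: pencils `K(λ)` with `K(λ) (Λ_s(λ)ᵀ ⊗ I_n) = 0`. -/
def IsWingPencil {s : ℕ} (K : PolyBlockMat F n s (s + 1)) : Prop :=
  IsPencil K ∧ K * lambdaCol F n s = 0

/-- The `k × k` block-matrix partitioned as `[[M, K₂ᵀ], [K₁, 0]]`. -/
noncomputable def assemble {p q k : ℕ} (hrow : q + 1 + p = k) (hcol : p + 1 + q = k)
    (M : PolyBlockMat F n (q + 1) (p + 1)) (K₁ : PolyBlockMat F n p (p + 1))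
    (K₂ : PolyBlockMat F n q (q + 1)) : PolyBlockMat F n k k :=
  Matrix.reindex (finSumFinEquiv.trans (finCongr hrow)) (finSumFinEquiv.trans (finCongr hcol))
    (Matrix.fromBlocks M (fullTranspose K₂) K₁ 0)

/-- `C(λ)` is an extended `(p, n, q, n)`-block Kronecker pencil with body `M(λ)`. -/
def IsExtendedBlockKronecker {k : ℕ} (p q : ℕ) (L : PolyBlockMat F n k k)
    (M : PolyBlockMat F n (q + 1) (p + 1)) : Prop :=
  IsPencil M ∧
  ∃ (hrow : q + 1 + p = k) (hcol : p + 1 + q = k)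
    (K₁ : PolyBlockMat F n p (p + 1)) (K₂ : PolyBlockMat F n q (q + 1)),
    IsWingPencil K₁ ∧ IsWingPencil K₂ ∧ L = assemble hrow hcol M K₁ K₂

/-- The antidiagonal sum of the pencil `M(λ) = λ M₁ + M₀` related to `s`: with `k = p + q + 1`
and blocks numbered from `1`, the sum of the `[M₁]_{ij}` with `i + j = k + 2 - s` and of the
`[M₀]_{ij}` with `i + j = k + 1 - s` (below, `i = a + 1` and `j = b + 1`). -/
noncomputable def antidiagSum {p q : ℕ} (M : PolyBlockMat F n (q + 1) (p + 1)) (s : ℕ) :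
    Matrix (Fin n) (Fin n) F :=
  ∑ a : Fin (q + 1), ∑ b : Fin (p + 1),
    ((if (a : ℕ) + b + s = p + q + 1 then matCoeff (M a b) 1 else 0) +
      (if (a : ℕ) + b + s + 1 = p + q + 1 then matCoeff (M a b) 0 else 0))

/-- `M(λ)` satisfies the AS condition for `P(λ)`, a matrix polynomial of grade `p + q + 1`. -/
def SatisfiesAS {p q : ℕ} (P : MatPoly F n) (M : PolyBlockMat F n (q + 1) (p + 1)) : Prop :=
  ∀ s ≤ p + q + 1, antidiagSum M s = matCoeff P s

/-! ### Elementary matrices and the pencil -/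

/-- The elementary matrix `M_i(B)`, `0 ≤ i ≤ k - 1`. With blocks numbered from `1`, it differs
from the identity only in the block-rows and block-columns `k - i` and `k - i + 1`, where it is
`[[B, I], [I, 0]]`; for `i = 0` only the block in position `(k, k)` is left, and it is `B`. -/
noncomputable def elementary (k i : ℕ) (B : Matrix (Fin n) (Fin n) F) : BlockMat F n k k :=
  fun a b =>
    if (a : ℕ) + i + 1 = k ∧ (b : ℕ) + i + 1 = k then B
    else if (a : ℕ) + i + 1 = k ∧ (b : ℕ) + i = k then 1
    else if (a : ℕ) + i = k ∧ (b : ℕ) + i + 1 = k then 1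
    else if a = b ∧ (a : ℕ) + i ≠ k then 1
    else 0

/-- `M_t(𝒳) = M_{t_1}(X_1) ⋯ M_{t_r}(X_r)`, for a tuple `t` of indices from `{0 : k - 1}` and a
matrix assignment `𝒳` for `t` (a list of matrices of the same length as `t`). -/
noncomputable def elementaryProd (k : ℕ) (t : List ℕ) (𝒳 : List (Matrix (Fin n) (Fin n) F)) :
    BlockMat F n k k :=
  (List.zipWith (elementary k) t 𝒳).prod

/-- `M_t^P`, where `M_i^P = M_i(-A_i)` for `0 ≤ i ≤ k - 1`. -/
noncomputable def elementaryProdOf (k : ℕ) (t : List ℕ) (P : MatPoly F n) : BlockMat F n k k :=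
  elementaryProd k t (t.map fun i => -matCoeff P i)

/-- `M_{-k}^P = diag(A_k, I_n, …, I_n)`. -/
noncomputable def elementaryNegTop (k : ℕ) (P : MatPoly F n) : BlockMat F n k k :=
  Matrix.diagonal fun a => if (a : ℕ) = 0 then matCoeff P k else 1

/-- The pencil `M_{ℓ_q}(𝒳) (λ M_{-k}^P - M_q^P) M_{r_q}(𝒴)`. -/
noncomputable def pencil (k : ℕ) (P : MatPoly F n) (lq q rq : List ℕ)
    (𝒳 𝒴 : List (Matrix (Fin n) (Fin n) F)) : PolyBlockMat F n k k :=
  constBlock (elementaryProd k lq 𝒳) *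
    ((X : F[X]) • constBlock (elementaryNegTop k P) - constBlock (elementaryProdOf k q P)) *
    constBlock (elementaryProd k rq 𝒴)

/-! ### Block-permutations, wing block-rows and wing block-columns -/

/-- The block-permutation matrix `Π_c^n`: its block in position `(c_i, i)` is `I_n` for every `i`,
and all other blocks vanish. Thus `L Π_r^n` has as its `i`th block-column the block-column `r_i`
of `L`, and `(Π_ℓ^n)^𝓑 L` has as its `i`th block-row the block-row `ℓ_i` of `L`. -/
noncomputable def blockPerm (F : Type*) [Field F] (n : ℕ) {k : ℕ} (c : Equiv.Perm (Fin k)) :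
    PolyBlockMat F n k k :=
  fun a i => if a = c i then 1 else 0

/-- The positions of the wing block-columns relative to `(ℓ, r, p, q)`, for any `ℓ`: those that
are not moved by `Π_r^n` to the first `p + 1` positions. -/
def wingCols {k : ℕ} (r : Equiv.Perm (Fin k)) (p : ℕ) : Set (Fin k) :=
  {c | ¬ ((r.symm c : Fin k) : ℕ) < p + 1}

/-- The positions of the wing block-rows relative to `(ℓ, r, p, q)`, for any `r`: those that
are not moved by `(Π_ℓ^n)^𝓑` to the first `q + 1` positions. -/
def wingRows {k : ℕ} (l : Equiv.Perm (Fin k)) (q : ℕ) : Set (Fin k) :=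
  {c | ¬ ((l.symm c : Fin k) : ℕ) < q + 1}

/-- The list of the blocks of `e_i ⊗ I_n` (or of `e_iᵀ ⊗ I_n`), with `i` counted from `1`. -/
noncomputable def unitBlocks (F : Type*) [Field F] (n k i : ℕ) : Fin k → MatPoly F n :=
  fun a => if (a : ℕ) + 1 = i then 1 else 0

/-- The list of the blocks of `-e_i ⊗ I_n + λ e_{i+1} ⊗ I_n` (or of its row version). -/
noncomputable def stdWing (F : Type*) [Field F] (n k i : ℕ) : Fin k → MatPoly F n :=
  -unitBlocks F n k i + (X : F[X]) • unitBlocks F n k (i + 1)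

/-- The positions of the wing block-columns of `N(λ)`, relative to `(id, r, p, q)`, that are of
the form `-e_i ⊗ I_n + λ e_{i+1} ⊗ I_n` with `1 ≤ i ≤ q`. -/
def stdWingCols {k : ℕ} (N : PolyBlockMat F n k k) (r : Equiv.Perm (Fin k)) (p q : ℕ) :
    Set (Fin k) :=
  {c | c ∈ wingCols r p ∧ ∃ i, 1 ≤ i ∧ i ≤ q ∧ (fun a => N a c) = stdWing F n k i}

/-- The positions of the wing block-rows of `N(λ)`, relative to `(ℓ, id, p, q)`, that are of
the form `-e_iᵀ ⊗ I_n + λ e_{i+1}ᵀ ⊗ I_n` with `1 ≤ i ≤ p`. -/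
def stdWingRows {k : ℕ} (N : PolyBlockMat F n k k) (l : Equiv.Perm (Fin k)) (p q : ℕ) :
    Set (Fin k) :=
  {c | c ∈ wingRows l q ∧ ∃ i, 1 ≤ i ∧ i ≤ p ∧ (fun b => N c b) = stdWing F n k i}

/-- The positions `k - j` (counted from `1`) with `j ∈ {0 : k - 2}` and `j ∉ heads(t)`. -/
def nonHeadPositions (k : ℕ) (t : List ℕ) : Set (Fin k) :=
  {c | ∃ j : ℕ, j + 2 ≤ k ∧ j ∉ heads t ∧ (c : ℕ) + 1 = k - j}

/-- No matrix of the assignment `𝒳` for `t` vanishes, and those assigned to the index `0` are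
different from `I_n`. -/
def GenericAssignment (t : List ℕ) (𝒳 : List (Matrix (Fin n) (Fin n) F)) : Prop :=
  ∀ z ∈ t.zip 𝒳, z.2 ≠ 0 ∧ (z.1 = 0 → z.2 ≠ 1)

end

end GFPR

open GFPR

namespace GFPR

/-! ### Heads of index tuples -/

/-! Everything is reduced to the Fiedler pencil λD - N of `q`, where D = diag(A_k, I, …, I) and N is
the product for `q`. Inserting the largest index one step at a time shows that independent
permutations of its block-rows and block-columns bring it to block Kronecker form, with wings equal
to the standard Kronecker pencils up to the signs in -e_i + λe_{i+1} and with a body satisfying AS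
(`exists_isFiedlerForm`). The block-column of index j (counting from 0, position k - 1 - j) is a
wing exactly when j is not a head of `q`. Rows behave in the same way with respect to the reversal
of `q`.

After suitable permutations the right factor becomes [[I, 0], [V, Z]] and, by transposition, the
left one becomes block upper triangular (`exists_isColumnFactor`). The reason is that the SIP says
exactly that each new index i is not a head of the tuple before it, and the column of a non-head is
still an untouched unit column in the wing region. So M_i(Y) writes Y into a wing row only, and
columns 0 to p of the identity change only below row p.

Such factors multiply the wings by constant matrices, which keeps them wings, and add multiples of
the wings to the body. The antidiagonal sums do not see these terms, because the two coefficients of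
the Kronecker pencil put the same blocks on the same antidiagonal with opposite signs
(`sum_antidiag_kron_mul`). Non-heads of the final tuple keep unit columns, hence standard wings. For
a generic assignment the other wing columns are not unit columns (`IsFiedlerForm.stdWingCols_eq`).

Heads are handled through `IsHead`, which is invariant under commutations, detects the right end
points of the column standard form, and is the obstruction to appending j within the SIP. -/

theorem sip_iff (t : List ℕ) :
    SIP t ↔ ∀ u v w x, t = u ++ x :: (v ++ x :: w) → x + 1 ∈ v := by
  constructor
  · rintro h u v w x rfl
    obtain ⟨c, h1, h2, h3⟩ := h ⟨u.length, by simp⟩ ⟨u.length + 1 + v.length, by simp; omega⟩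
      (by simp [Fin.lt_def]; omega)
      (by simp [List.getElem_append, List.getElem_cons]
          rw [dif_neg (by omega)]
          simp [show u.length + 1 + v.length - u.length - 1 = v.length by omega])
    obtain ⟨c, hc⟩ := c
    simp only [Fin.lt_def] at h1 h2
    simp only [List.get_eq_getElem, List.getElem_append, List.getElem_cons] at h3
    rw [dif_neg (by omega), dif_neg (by omega), dif_pos (by omega)] at h3
    simp at h3
    rw [← h3]
    exact List.getElem_mem _
  · intro h a b hab heq
    have hb := b.2
    have hab' : a.1 < b.1 := hab
    have e : t = t.take a ++ t.get a :: ((t.drop (a + 1)).take (b - a - 1) ++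
        t.get a :: t.drop (b + 1)) := by
      conv_lhs => rw [← List.take_append_drop a t]
      congr 1
      rw [List.drop_eq_getElem_cons a.2]
      simp only [List.get_eq_getElem]
      congr 1
      conv_lhs => rw [← List.take_append_drop (b - a - 1) (t.drop (a + 1))]
      congr 1
      rw [List.drop_drop, show a.1 + 1 + (b.1 - a - 1) = b by omega,
        List.drop_eq_getElem_cons b.2]
      simp only [List.get_eq_getElem] at heq
      rw [heq]
    have hm := h _ _ _ _ e
    obtain ⟨i, hi, he⟩ := List.getElem_of_mem hm
    simp only [List.length_take, List.length_drop] at hi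
    refine ⟨⟨a + 1 + i, by omega⟩, ?_, ?_, ?_⟩
    · simp [Fin.lt_def]; omega
    · simp [Fin.lt_def]; omega
    · rw [← he]; simp

theorem SIP.of_append {u v w : List ℕ} (h : SIP (u ++ v ++ w)) : SIP v := by
  rw [sip_iff] at h ⊢
  rintro a b c x rfl
  exact h (u ++ a) b (c ++ w) x (by simp)

theorem SIP.reverse {t : List ℕ} (h : SIP t) : SIP t.reverse := by
  rw [sip_iff] at h ⊢
  intro u v w x e
  have := h w.reverse v.reverse u.reverse x (by
    rw [← List.reverse_reverse t, e]; simp)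
  simpa using this

/-- The last of the indices `j` and `j + 1` in the tuple is `j`. -/
def IsHead (t : List ℕ) (j : ℕ) : Prop :=
  (t.filter (fun x => x = j ∨ x = j + 1)).getLast? = some j

theorem isHead_append (s u : List ℕ) (j : ℕ) :
    IsHead (s ++ u) j ↔ IsHead u j ∨ (j ∉ u ∧ j + 1 ∉ u ∧ IsHead s j) := by
  unfold IsHead
  rw [List.filter_append, List.getLast?_append]
  by_cases h : u.filter (fun x => x = j ∨ x = j + 1) = []
  · have h' := List.filter_eq_nil_iff.1 h
    have h1 : j ∉ u := fun hj => by simpa using h' j hj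
    have h2 : j + 1 ∉ u := fun hj => by simpa using h' _ hj
    rw [h]
    simp only [List.getLast?_nil, Option.none_or, h1, h2, not_false_eq_true, true_and, reduceCtorEq,
      false_or]
  · have h1 : j ∈ u ∨ j + 1 ∈ u := by
      obtain ⟨x, hx⟩ := List.exists_mem_of_ne_nil _ h
      simp only [List.mem_filter, decide_eq_true_eq] at hx
      obtain ⟨hx, rfl | rfl⟩ := hx <;> simp [hx]
    rw [List.getLast?_eq_some_getLast h]
    simp only [Option.some_or]
    tauto

theorem isHead_append_singleton (t : List ℕ) (i j : ℕ) :
    IsHead (t ++ [i]) j ↔ i = j ∨ (i ≠ j + 1 ∧ IsHead t j) := by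
  rw [isHead_append]
  have : IsHead [i] j ↔ i = j := by
    unfold IsHead
    by_cases h : i = j ∨ i = j + 1
    · simp [h]
    · simp [h]; tauto
  simp only [this, List.mem_singleton]
  constructor
  · rintro (h | ⟨-, h2, h3⟩)
    · exact .inl h
    · exact .inr ⟨fun h => h2 h.symm, h3⟩
  · rintro (h | ⟨h2, h3⟩)
    · exact .inl h
    · by_cases h : i = j
      · exact .inl h
      · exact .inr ⟨fun h' => h h'.symm, fun h => h2 h.symm, h3⟩

theorem isHead_append_of_mem {s u : List ℕ} {j : ℕ} (h : j ∈ u) :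
    IsHead (s ++ u) j ↔ IsHead u j := by
  rw [isHead_append]; tauto

theorem isHead_iff_exists (t : List ℕ) (j : ℕ) :
    IsHead t j ↔ ∃ u v, t = u ++ j :: v ∧ j + 1 ∉ v := by
  induction t using List.reverseRecOn with
  | nil => simp [IsHead]
  | append_singleton t i ih =>
    rw [isHead_append_singleton, ih]
    constructor
    · rintro (rfl | ⟨h, u, v, rfl, h2⟩)
      · exact ⟨t, [], rfl, by simp⟩
      · exact ⟨u, v ++ [i], by simp, by simp [h2]; exact fun h' => h h'.symm⟩
    · rintro ⟨u, v, e, h⟩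
      rcases List.eq_nil_or_concat v with rfl | ⟨v, y, rfl⟩
      · left
        have := congrArg List.getLast? e
        simpa using this
      · right
        rw [List.concat_eq_append] at e h
        have e' : t ++ [i] = (u ++ j :: v) ++ [y] := by simpa using e
        obtain ⟨rfl, h2⟩ := List.append_inj' e' rfl
        simp at h2; subst h2
        simp at h
        exact ⟨fun h' => h.2 h'.symm, u, v, rfl, h.1⟩

theorem isHead_of_max {t : List ℕ} {j : ℕ} (h : j ∈ t) (h' : j + 1 ∉ t) : IsHead t j := by
  obtain ⟨u, v, rfl⟩ := List.append_of_mem h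
  exact (isHead_iff_exists _ _).2 ⟨u, v, rfl, by simp at h'; tauto⟩

theorem IsHead.mem {t : List ℕ} {j : ℕ} (h : IsHead t j) : j ∈ t := by
  obtain ⟨u, v, rfl, -⟩ := (isHead_iff_exists _ _).1 h
  simp

/-- The only new pairs of equal indices end at the appended `j`. Such a pair violates the SIP
precisely when some earlier `j` has no `j + 1` after it. -/
theorem SIP.append_singleton_iff {t : List ℕ} (h : SIP t) (j : ℕ) :
    ¬ IsHead t j ↔ SIP (t ++ [j]) := by
  rw [sip_iff] at h ⊢
  rw [isHead_iff_exists]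
  constructor
  · intro hn u v w x e
    rcases List.eq_nil_or_concat w with rfl | ⟨w, y, rfl⟩
    · have e' : t ++ [j] = (u ++ x :: v) ++ [x] := by simpa using e
      obtain ⟨rfl, h2⟩ := List.append_inj' e' rfl
      simp at h2; subst h2
      by_contra hc
      exact hn ⟨u, v, rfl, hc⟩
    · rw [List.concat_eq_append] at e
      have e' : t ++ [j] = (u ++ x :: (v ++ x :: w)) ++ [y] := by simpa using e
      obtain ⟨rfl, h2⟩ := List.append_inj' e' rfl
      exact h _ _ _ _ rfl
  · rintro hs ⟨u, v, rfl, hv⟩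
    exact hv (hs u v [] j (by simp))

/-- The indices `j` and `j + 1` never change places, so the subsequence formed by them is an
invariant. -/
theorem isHead_congr_of_tupleEquiv {t t' : List ℕ} (h : TupleEquiv t t') (j : ℕ) :
    IsHead t j ↔ IsHead t' j := by
  have key : t.filter (fun x => x = j ∨ x = j + 1) = t'.filter (fun x => x = j ∨ x = j + 1) := by
    induction h with
    | refl => rfl
    | tail _ hs ih =>
      rw [ih]
      obtain ⟨u, v, x, y, h1, h2, h3, rfl, rfl⟩ := hs
      rw [List.filter_append, List.filter_append]
      congr 1
      by_cases hx : x = j ∨ x = j + 1 <;> by_cases hy : y = j ∨ y = j + 1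
      · omega
      all_goals simp [hx, hy]
  unfold IsHead
  rw [key]

/-! ### Strings and the column standard form. -/

theorem mem_string (s : ℕ × ℕ) (y : ℕ) : y ∈ string s ↔ s.1 ≤ y ∧ y ≤ s.2 := by
  simp [string, List.mem_range']
  constructor
  · rintro ⟨i, h, rfl⟩; omega
  · intro h; exact ⟨y - s.1, by omega, by omega⟩

theorem isHead_string {a b : ℕ} (h : a ≤ b) (j : ℕ) : IsHead (string (a, b)) j ↔ j = b := by
  obtain ⟨m, rfl⟩ := Nat.exists_eq_add_of_le h
  rw [string, show a + m + 1 - a = m + 1 by omega]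
  clear h
  induction m generalizing j with
  | zero => simpa [eq_comm] using isHead_append_singleton [] a j |>.trans (by simp [IsHead])
  | succ m ih =>
    dsimp only at ih ⊢
    rw [List.range'_concat, isHead_append_singleton, ih]
    omega

/-- Inside an increasing string only the last entry is a head. It stays one, since all later strings
lie strictly below it. -/
theorem isHead_flatten_iff {S : List (ℕ × ℕ)} (h : IsColumnStandard S) (j : ℕ) :
    IsHead (S.map string).flatten j ↔ ∃ a, (a, j) ∈ S := by
  induction S with
  | nil => simp [IsHead]
  | cons s S ih =>
    obtain ⟨h1, h2⟩ := h
    rw [List.pairwise_cons] at h2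
    have hS : IsColumnStandard S := ⟨fun s hs => h1 s (by simp [hs]), h2.2⟩
    obtain ⟨a, b⟩ := s
    have hab : a ≤ b := h1 (a, b) (by simp)
    rw [List.map_cons, List.flatten_cons, isHead_append, ih hS, isHead_string hab]
    have hlt : ∀ y ∈ (S.map string).flatten, y < b := by
      intro y hy
      simp only [List.mem_flatten, List.mem_map] at hy
      obtain ⟨_, ⟨s, hs, rfl⟩, hy⟩ := hy
      have := h2.1 s hs
      rw [mem_string] at hy
      exact lt_of_le_of_lt hy.2 this
    constructor
    · rintro (⟨a', h⟩ | ⟨-, -, rfl⟩)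
      · exact ⟨a', by simp [h]⟩
      · exact ⟨a, by simp⟩
    · rintro ⟨a', h⟩
      rcases List.mem_cons.1 h with h | h
      · right
        simp only [Prod.mk.injEq] at h
        obtain ⟨rfl, rfl⟩ := h
        exact ⟨fun h => (hlt _ h).ne rfl, fun h => by have := hlt _ h; omega, rfl⟩
      · exact .inl ⟨a', h⟩

theorem TupleEquiv.append {t t' : List ℕ} (h : TupleEquiv t t') (u v : List ℕ) :
    TupleEquiv (u ++ t ++ v) (u ++ t' ++ v) := by
  induction h with
  | refl => exact .refl
  | tail _ hs ih =>
    refine ih.tail ?_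
    obtain ⟨a, b, x, y, h1, h2, h3, rfl, rfl⟩ := hs
    exact ⟨u ++ a, b ++ v, x, y, h1, h2, h3, by simp, by simp⟩

theorem tupleEquiv_move {v : List ℕ} {x : ℕ} (h : ∀ y ∈ v, y + 2 ≤ x) :
    TupleEquiv (v ++ [x]) (x :: v) := by
  induction v with
  | nil => exact .refl
  | cons y v ih =>
    have h1 := (ih fun z hz => h z (by simp [hz])).append [y] []
    have hy := h y (by simp)
    simp only [List.append_nil] at h1
    exact h1.tail ⟨[], v, y, x, by omega, by omega, by omega, by simp, by simp⟩

/-- Compare `x` with the largest end point b. If x = b + 1, it commutes past the other strings and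
prolongs the first one; if x > b + 1, it commutes to the front as a new string; if x < b, the
insertion happens among the remaining strings. The control of the new end points keeps them
decreasing in the recursive case. -/
theorem exists_columnStandard_insert {S : List (ℕ × ℕ)} (h : IsColumnStandard S) (x : ℕ)
    (hx : ∀ s ∈ S, s.2 ≠ x) :
    ∃ S', IsColumnStandard S' ∧
      TupleEquiv ((S.map string).flatten ++ [x]) (S'.map string).flatten ∧
      ∀ s ∈ S', s.2 = x ∨ ∃ s' ∈ S, s'.2 = s.2 := by
  induction S with
  | nil => exact ⟨[(x, x)], ⟨by simp, by simp⟩, by simp [string]; exact .refl, by simp⟩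
  | cons s S ih =>
    obtain ⟨h1, h2⟩ := h
    rw [List.pairwise_cons] at h2
    have hS : IsColumnStandard S := ⟨fun s hs => h1 s (by simp [hs]), h2.2⟩
    obtain ⟨a, b⟩ := s
    have hab : a ≤ b := h1 (a, b) (by simp)
    have hlt : ∀ y ∈ (S.map string).flatten, y < b := by
      intro y hy
      simp only [List.mem_flatten, List.mem_map] at hy
      obtain ⟨_, ⟨s, hs, rfl⟩, hy⟩ := hy
      have := h2.1 s hs
      rw [mem_string] at hy
      exact lt_of_le_of_lt hy.2 this
    have hbx : b ≠ x := hx (a, b) (by simp)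
    rcases lt_or_gt_of_ne hbx with hb | hb
    · rcases Nat.eq_or_lt_of_le (Nat.succ_le_of_lt hb) with hb' | hb'
      · have hb' : x = b + 1 := hb'.symm
        subst hb'
        refine ⟨(a, b + 1) :: S, ⟨?_, ?_⟩, ?_, ?_⟩
        · intro s hs
          rcases List.mem_cons.1 hs with rfl | hs
          · simp; omega
          · exact hS.1 s hs
        · rw [List.pairwise_cons]
          exact ⟨fun s hs => (h2.1 s hs).trans hb, h2.2⟩
        · have e : string (a, b + 1) = string (a, b) ++ [b + 1] := by
            obtain ⟨m, rfl⟩ := Nat.exists_eq_add_of_le hab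
            simp only [string]
            rw [show a + m + 1 + 1 - a = m + 1 + 1 by omega, show a + m + 1 - a = m + 1 by omega,
              List.range'_concat]
            simp; omega
          have := (tupleEquiv_move (v := (S.map string).flatten) (x := b + 1)
            (fun y hy => by have := hlt y hy; omega)).append (string (a, b)) []
          simpa [e] using this
        · intro s hs
          rcases List.mem_cons.1 hs with rfl | hs
          · exact .inl rfl
          · exact .inr ⟨s, by simp [hs], rfl⟩
      · refine ⟨(x, x) :: (a, b) :: S, ⟨?_, ?_⟩, ?_, ?_⟩
        · intro s hs
          rcases List.mem_cons.1 hs with rfl | hs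
          · simp
          · exact h1 s hs
        · rw [List.pairwise_cons, List.pairwise_cons]
          refine ⟨fun s hs => ?_, h2⟩
          rcases List.mem_cons.1 hs with rfl | hs
          · exact hb
          · exact (h2.1 s hs).trans hb
        · have := tupleEquiv_move (v := (((a, b) :: S).map string).flatten) (x := x) (by
            intro y hy
            rw [List.map_cons, List.flatten_cons, List.mem_append, mem_string] at hy
            rcases hy with hy | hy
            · simp at hy; omega
            · have := hlt y hy; omega)
          simpa [string] using this
        · intro s hs
          rcases List.mem_cons.1 hs with rfl | hs
          · exact .inl rfl
          · exact .inr ⟨s, hs, rfl⟩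
    · obtain ⟨S', hS', he, hh⟩ := ih hS (fun s hs => hx s (by simp [hs]))
      refine ⟨(a, b) :: S', ⟨?_, ?_⟩, ?_, ?_⟩
      · intro s hs
        rcases List.mem_cons.1 hs with rfl | hs
        · exact hab
        · exact hS'.1 s hs
      · rw [List.pairwise_cons]
        refine ⟨fun s hs => ?_, hS'.2⟩
        rcases hh s hs with e | ⟨s', hs', e⟩
        · rw [e]; exact hb
        · rw [← e]; exact h2.1 s' hs'
      · have := he.append (string (a, b)) []
        simpa using this
      · intro s hs
        rcases List.mem_cons.1 hs with rfl | hs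
        · exact .inr ⟨(a, b), by simp, rfl⟩
        · rcases hh s hs with e | ⟨s', hs', e⟩
          · exact .inl e
          · exact .inr ⟨s', by simp [hs'], e⟩

theorem SIP.exists_columnStandard {t : List ℕ} (h : SIP t) :
    ∃ S, IsColumnStandard S ∧ TupleEquiv t (S.map string).flatten := by
  induction t using List.reverseRecOn with
  | nil => exact ⟨[], ⟨by simp, by simp⟩, .refl⟩
  | append_singleton t x ih =>
    have ht : SIP t := SIP.of_append (u := []) h
    obtain ⟨S, hS, he⟩ := ih ht
    have hx := (ht.append_singleton_iff x).2 h
    rw [isHead_congr_of_tupleEquiv he, isHead_flatten_iff hS] at hx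
    obtain ⟨S', hS', he', -⟩ := exists_columnStandard_insert hS x
      (fun s hs e => hx ⟨s.1, by rw [← e]; exact hs⟩)
    exact ⟨S', hS', (he.append [] [x]).trans he'⟩

/-- Uniqueness of the column standard form is not needed: every such form has the same end points,
because `IsHead` is invariant. -/
theorem SIP.heads_eq {t : List ℕ} (h : SIP t) : heads t = {j | IsHead t j} := by
  ext j
  simp only [heads, Set.mem_ofPred_eq]
  constructor
  · rintro ⟨S, hS, he, ha⟩
    rw [isHead_congr_of_tupleEquiv he, isHead_flatten_iff hS]
    exact ha
  · intro hj
    obtain ⟨S, hS, he⟩ := h.exists_columnStandard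
    rw [isHead_congr_of_tupleEquiv he, isHead_flatten_iff hS] at hj
    exact ⟨S, hS, he, hj⟩

section
variable {F : Type*} [Field F] {n : ℕ}

/-! ### Multiplication by elementary matrices -/

theorem elementary_apply_col_fst {k i : ℕ} (B : Matrix (Fin n) (Fin n) F) {c : Fin k}
    (hc : (c : ℕ) + i + 1 = k) (a : Fin k) :
    elementary k i B a c = if a = c then B else if (a : ℕ) = c + 1 then 1 else 0 := by
  unfold elementary
  simp only [Fin.ext_iff]
  split_ifs <;> first | rfl | (exfalso; omega)

theorem elementary_apply_col_snd {k i : ℕ} (B : Matrix (Fin n) (Fin n) F) {d : Fin k}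
    (hd : (d : ℕ) + i = k) (a : Fin k) :
    elementary k i B a d = if (a : ℕ) + 1 = d then 1 else 0 := by
  unfold elementary
  simp only [Fin.ext_iff]
  split_ifs <;> first | rfl | (exfalso; omega)

theorem elementary_apply_col_of_ne {k i : ℕ} (B : Matrix (Fin n) (Fin n) F) {y : Fin k}
    (h1 : (y : ℕ) + i + 1 ≠ k) (h2 : (y : ℕ) + i ≠ k) (a : Fin k) :
    elementary k i B a y = if a = y then 1 else 0 := by
  unfold elementary
  simp only [Fin.ext_iff]
  split_ifs <;> first | rfl | (exfalso; omega)

variable {m k i : ℕ} (A : BlockMat F n m k) (B : Matrix (Fin n) (Fin n) F)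

theorem mul_elementary_col_last {c : Fin k} (hc : (c : ℕ) + 1 = k) (x : Fin m) :
    (A * elementary k 0 B) x c = A x c * B := by
  rw [Matrix.mul_apply, Finset.sum_eq_single c]
  · rw [elementary_apply_col_fst B (by omega)]; simp
  · intro a _ ha
    rw [elementary_apply_col_fst B (by omega), if_neg ha, if_neg (by omega), mul_zero]
  · simp

theorem mul_elementary_col_fst {c d : Fin k} (hc : (c : ℕ) + i + 1 = k) (hd : (d : ℕ) + i = k)
    (x : Fin m) : (A * elementary k i B) x c = A x c * B + A x d := by
  have hcd : c ≠ d := by rw [Ne, Fin.ext_iff]; omega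
  rw [Matrix.mul_apply, Finset.sum_eq_add c d hcd]
  · rw [elementary_apply_col_fst B hc, elementary_apply_col_fst B hc, if_pos rfl,
      if_neg hcd.symm, if_pos (by omega), mul_one]
  · rintro a - ⟨h1, h2⟩
    rw [elementary_apply_col_fst B hc, if_neg h1, if_neg, mul_zero]
    intro h; exact h2 (Fin.ext (by omega))
  · simp
  · simp

theorem mul_elementary_col_snd {c d : Fin k} (hc : (c : ℕ) + i + 1 = k) (hd : (d : ℕ) + i = k)
    (x : Fin m) : (A * elementary k i B) x d = A x c := by
  rw [Matrix.mul_apply, Finset.sum_eq_single c]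
  · rw [elementary_apply_col_snd B hd, if_pos (by omega), mul_one]
  · intro a _ ha
    rw [elementary_apply_col_snd B hd, if_neg, mul_zero]
    intro h; exact ha (Fin.ext (by omega))
  · simp

theorem mul_elementary_col_of_ne {y : Fin k} (h1 : (y : ℕ) + i + 1 ≠ k) (h2 : (y : ℕ) + i ≠ k)
    (x : Fin m) : (A * elementary k i B) x y = A x y := by
  rw [Matrix.mul_apply, Finset.sum_eq_single y]
  · rw [elementary_apply_col_of_ne B h1 h2, if_pos rfl, mul_one]
  · intro a _ ha
    rw [elementary_apply_col_of_ne B h1 h2, if_neg ha, mul_zero]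
  · simp

theorem elementaryProd_append (k : ℕ) {t : List ℕ} {𝒳 : List (Matrix (Fin n) (Fin n) F)}
    (h : t.length = 𝒳.length) (t' : List ℕ) (𝒳' : List (Matrix (Fin n) (Fin n) F)) :
    elementaryProd k (t ++ t') (𝒳 ++ 𝒳') = elementaryProd k t 𝒳 * elementaryProd k t' 𝒳' := by
  rw [elementaryProd, List.zipWith_append h, List.prod_append]; rfl

theorem elementaryProd_singleton (k i : ℕ) (B : Matrix (Fin n) (Fin n) F) :
    elementaryProd k [i] [B] = elementary k i B := by
  simp [elementaryProd]

/-! ### Right multiplication by a product of elementary matrices -/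

/-- The factor `U` relating, after the column permutation `r`, a product of elementary matrices
for the tuple `rq` to the arrangement in which the columns `b ≥ m` are the wing block-columns,
and `t` is the current tuple of indices. -/
structure IsColumnFactor {k : ℕ} (m : ℕ) (t : List ℕ) (r : Equiv.Perm (Fin k))
    (U : BlockMat F n k k) (generic : Prop) : Prop where
  perm_zero : ∀ i : Fin k, (i : ℕ) = 0 → r i = i
  row_lt : ∀ a b : Fin k, (a : ℕ) < m → U a b = if a = b then 1 else 0
  col_zero : ∀ a b : Fin k, (b : ℕ) = 0 → U a b = if a = b then 1 else 0
  le_of_not_isHead : ∀ b : Fin k, ¬ IsHead t (k - 1 - r b) → m ≤ (b : ℕ)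
  col_of_not_isHead : ∀ b : Fin k, ¬ IsHead t (k - 1 - r b) →
    ∀ a, U a b = if a = b then 1 else 0
  -- Triangularity in the order given by `r`; it excludes cancellation when a new matrix is written
  -- into `U`.
  lt_of_ne_zero : ∀ a b : Fin k, a ≠ b → U a b ≠ 0 → r b < r a
  -- The nonzero diagonal block excludes every unit column except that of `b`, and the disjunction
  -- excludes that one.
  col_of_isHead : generic → ∀ b : Fin k, m ≤ (b : ℕ) → IsHead t (k - 1 - r b) →
    U b b ≠ 0 ∧ (U b b ≠ 1 ∨ ∃ a, a ≠ b ∧ U a b ≠ 0)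

/-- Effect of M_0(Y): as 0 is not a head, the last column is a unit column of the wing region, so
only its diagonal block changes, from I to Y. -/
theorem IsColumnFactor.scale {k m : ℕ} {t : List ℕ} {r : Equiv.Perm (Fin k)}
    {U U' : BlockMat F n k k} {g g' : Prop} (h : IsColumnFactor m t r U g) (hm : 0 < m)
    {c : Fin k} (hc : (c : ℕ) + 1 = k) (ht : ¬ IsHead t 0) (Y : Matrix (Fin n) (Fin n) F)
    (hg : g' → g ∧ Y ≠ 0 ∧ Y ≠ 1)
    (hU : ∀ a b, U' a b = if r b = c then U a b * Y else U a b) :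
    IsColumnFactor m (t ++ [0]) r U' g' := by
  have hcb : ∀ b, ¬ IsHead (t ++ [0]) (k - 1 - r b) → r b ≠ c ∧ ¬ IsHead t (k - 1 - r b) := by
    intro b hb
    rw [isHead_append_singleton] at hb
    push Not at hb
    exact ⟨fun e => hb.1 (by rw [e]; omega), hb.2 (by omega)⟩
  have hd : ∀ b, r b = c → m ≤ (b : ℕ) ∧ ∀ a, U a b = if a = b then 1 else 0 := by
    intro b hb
    have : ¬ IsHead t (k - 1 - r b) := by rw [hb, show k - 1 - (c : ℕ) = 0 by omega]; exact ht
    exact ⟨h.le_of_not_isHead b this, h.col_of_not_isHead b this⟩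
  refine ⟨h.perm_zero, ?_, ?_, ?_, ?_, ?_, ?_⟩
  · intro a b ha
    rw [hU, h.row_lt a b ha]
    split_ifs with h1 h2 <;> try simp
    subst h2
    have := (hd a h1).1
    omega
  · intro a b hb
    rw [hU, if_neg, h.col_zero a b hb]
    intro e
    have := (hd b e).1
    omega
  · intro b hb
    exact h.le_of_not_isHead b (hcb b hb).2
  · intro b hb a
    rw [hU, if_neg (hcb b hb).1]
    exact h.col_of_not_isHead b (hcb b hb).2 a
  · intro a b hab hne
    apply h.lt_of_ne_zero a b hab
    intro e
    apply hne
    rw [hU, e]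
    simp
  · intro g b hb hh
    obtain ⟨hg, hY0, hY1⟩ := hg g
    by_cases e : r b = c
    · have : U' b b = Y := by rw [hU, if_pos e, (hd b e).2]; simp
      rw [this]
      exact ⟨hY0, .inl hY1⟩
    · have hU' : ∀ a, U' a b = U a b := fun a => by rw [hU, if_neg e]
      simp only [hU']
      refine h.col_of_isHead hg b hb ?_
      rw [isHead_append_singleton] at hh
      rcases hh with hh | hh
      · exact absurd (Fin.ext (by have := (r b).2; omega)) e
      · exact hh.2

/-- Effect of M_i(Y) with i ≥ 1. As i is not a head, column c is a unit column e_s with s in the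
wing region. It moves to d, whose index i - 1 is no head of the new tuple, while the old column d
moves to c and acquires Y in row s. Composing `r` with the transposition of c and d absorbs the
move, so `U` only gains the block Y. -/
theorem IsColumnFactor.swap {k m i : ℕ} {t : List ℕ} {r : Equiv.Perm (Fin k)}
    {U U' : BlockMat F n k k} {g g' : Prop} (h : IsColumnFactor m t r U g)
    (hi : i + 2 ≤ k)
    {c d : Fin k} (hc : (c : ℕ) + i + 1 = k) (hd : (d : ℕ) + i = k)
    (ht : ¬ IsHead t i) (Y : Matrix (Fin n) (Fin n) F) (hg : g' → g ∧ Y ≠ 0)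
    (hU1 : ∀ a, U' a (r.symm c) = U a (r.symm c))
    (hU2 : ∀ a, U' a (r.symm d) = U a (r.symm c) * Y + U a (r.symm d))
    (hU3 : ∀ a b, r b ≠ c → r b ≠ d → U' a b = U a b) :
    IsColumnFactor m (t ++ [i]) (r.trans (Equiv.swap c d)) U' g' := by
  have hcd : c ≠ d := by rw [Ne, Fin.ext_iff]; omega
  set s : Fin k := r.symm c with hs
  set e : Fin k := r.symm d with he
  have hrs : r s = c := by simp [hs]
  have hre : r e = d := by simp [he]
  have hse : s ≠ e := fun h => hcd (by rw [← hrs, ← hre, h])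
  have hns : ¬ IsHead t (k - 1 - r s) := by
    rw [hrs, show k - 1 - (c : ℕ) = i by omega]; exact ht
  have hms := h.le_of_not_isHead s hns
  have hcs := h.col_of_not_isHead s hns
  have hcase : ∀ b, b = s ∨ b = e ∨ (r b ≠ c ∧ r b ≠ d) := by
    intro b
    by_cases h1 : r b = c
    · left; rw [hs, ← h1]; simp
    · by_cases h2 : r b = d
      · right; left; rw [he, ← h2]; simp
      · exact .inr (.inr ⟨h1, h2⟩)
  have hr's : (r.trans (Equiv.swap c d)) s = d := by simp [hrs]
  have hr'e : (r.trans (Equiv.swap c d)) e = c := by simp [hre]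
  have hr' : ∀ b, r b ≠ c → r b ≠ d → (r.trans (Equiv.swap c d)) b = r b := by
    intro b h1 h2
    simp [Equiv.swap_apply_of_ne_of_ne h1 h2]
  generalize hr'd : r.trans (Equiv.swap c d) = r' at *
  have hU2' : ∀ a, U' a e = (if a = s then Y else 0) + U a e := by
    intro a
    rw [hU2, hcs]
    split_ifs <;> simp
  have hhe : IsHead (t ++ [i]) (k - 1 - r' e) := by
    rw [hr'e, isHead_append_singleton]; left; omega
  have hho : ∀ b, r b ≠ c → r b ≠ d →
      (IsHead (t ++ [i]) (k - 1 - r' b) ↔ IsHead t (k - 1 - r b)) := by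
    intro b h1 h2
    rw [hr' b h1 h2, isHead_append_singleton]
    have h1 : (r b : ℕ) ≠ c := fun h => h1 (Fin.ext h)
    have h2 : (r b : ℕ) ≠ d := fun h => h2 (Fin.ext h)
    have := (r b).2
    constructor
    · rintro (h | h)
      · omega
      · exact h.2
    · intro h
      exact .inr ⟨by omega, h⟩
  -- Because i ≤ k - 2, the first column is never involved.
  have hr0 : ∀ j : Fin k, (j : ℕ) = 0 → r j ≠ c ∧ r j ≠ d := by
    intro j hj
    rw [h.perm_zero j hj]
    constructor <;> (rw [Ne, Fin.ext_iff]; omega)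
  refine ⟨?_, ?_, ?_, ?_, ?_, ?_, ?_⟩
  · intro j hj
    rw [hr' j (hr0 j hj).1 (hr0 j hj).2, h.perm_zero j hj]
  · intro a b ha
    rcases hcase b with rfl | rfl | ⟨h1, h2⟩
    · rw [hU1, h.row_lt _ _ ha]
    · rw [hU2', if_neg (by rintro rfl; omega), zero_add, h.row_lt _ _ ha]
    · rw [hU3 a b h1 h2, h.row_lt _ _ ha]
  · intro a b hb
    rw [hU3 a b (hr0 b hb).1 (hr0 b hb).2, h.col_zero a b hb]
  · intro b hb
    rcases hcase b with rfl | rfl | ⟨h1, h2⟩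
    · exact hms
    · exact absurd hhe hb
    · exact h.le_of_not_isHead b (by rwa [hho b h1 h2] at hb)
  · intro b hb a
    rcases hcase b with rfl | rfl | ⟨h1, h2⟩
    · rw [hU1, hcs]
    · exact absurd hhe hb
    · rw [hU3 a b h1 h2]
      exact h.col_of_not_isHead b (by rwa [hho b h1 h2] at hb) a
  · intro a b hab hne
    rcases hcase b with rfl | rfl | ⟨h1, h2⟩
    · rw [hU1, hcs, if_neg hab] at hne
      exact absurd rfl hne
    · rw [hr'e]
      by_cases has : a = s
      · rw [has, hr's, Fin.lt_def]; omega
      · rw [hU2', if_neg has, zero_add] at hne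
        have := h.lt_of_ne_zero a e hab hne
        rw [hre, Fin.lt_def] at this
        rw [hr' a (fun h => by rw [h] at this; omega) (fun h => by rw [h] at this; omega),
          Fin.lt_def]
        omega
    · rw [hU3 a b h1 h2] at hne
      have := h.lt_of_ne_zero a b hab hne
      rw [hr' b h1 h2]
      rcases hcase a with rfl | rfl | ⟨h3, h4⟩
      · rw [hr's]
        rw [hrs] at this
        rw [Fin.lt_def] at *
        omega
      · rw [hr'e]
        rw [hre] at this
        have h1 : (r b : ℕ) ≠ c := fun h => h1 (Fin.ext h)
        rw [Fin.lt_def] at *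
        omega
      · rwa [hr' a h3 h4]
  · intro g b hb hh
    obtain ⟨hg, hY⟩ := hg g
    rcases hcase b with rfl | rfl | ⟨h1, h2⟩
    · exfalso
      rw [hr's, isHead_append_singleton] at hh
      omega
    · have hee : U' e e = U e e := by rw [hU2', if_neg hse.symm, zero_add]
      refine ⟨?_, .inr ⟨s, hse, ?_⟩⟩
      · rw [hee]
        by_cases hh' : IsHead t (k - 1 - r e)
        · exact (h.col_of_isHead hg e hb hh').1
        -- The diagonal block is the identity, which could vanish only for n = 0, and then Y would
        -- vanish too.
        · rw [h.col_of_not_isHead e hh', if_pos rfl]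
          intro h1
          apply hY
          rw [← mul_one Y, h1, mul_zero]
      -- By triangularity this block was empty before, so the new block is exactly Y.
      · have : U s e = 0 := by
          by_contra hne
          have := h.lt_of_ne_zero s e hse hne
          rw [hrs, hre, Fin.lt_def] at this
          omega
        rw [hU2', if_pos rfl, this, add_zero]
        exact hY
    · simp only [hU3 _ b h1 h2]
      exact h.col_of_isHead hg b hb (by rwa [hho b h1 h2] at hh)

/-- Induction on the last index of `rq`. For empty `rq` the factor is the identity and the wing
columns are the non-heads of `q`; afterwards the SIP provides the non-head hypothesis of each step.
-/
theorem exists_isColumnFactor {k m : ℕ} {q : List ℕ} (hm : 0 < m) (r₀ : Equiv.Perm (Fin k))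
    (h0 : ∀ i : Fin k, (i : ℕ) = 0 → r₀ i = i)
    (hmr : ∀ b : Fin k, m ≤ (b : ℕ) ↔ ¬ IsHead q (k - 1 - r₀ b))
    (rq : List ℕ) (hrq : ∀ i ∈ rq, i + 2 ≤ k) (hsip : SIP (q ++ rq))
    (𝒴 : List (Matrix (Fin n) (Fin n) F)) (h𝒴 : 𝒴.length = rq.length) :
    ∃ r, IsColumnFactor m (q ++ rq) r ((elementaryProd k rq 𝒴).submatrix r₀ r)
      (GenericAssignment rq 𝒴) := by
  induction rq using List.reverseRecOn generalizing 𝒴 with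
  | nil =>
    refine ⟨r₀, ?_⟩
    have : ((elementaryProd k [] 𝒴).submatrix r₀ r₀ : BlockMat F n k k) = 1 := by
      simp [elementaryProd]
    rw [this, List.append_nil]
    refine ⟨h0, fun a b _ => Matrix.one_apply, fun a b _ => Matrix.one_apply,
      fun b => (hmr b).2, fun b _ a => Matrix.one_apply, fun a b hab hne => ?_, fun _ b hb hh => ?_⟩
    · exact absurd (Matrix.one_apply_ne hab) hne
    · exact absurd hh ((hmr b).1 hb)
  | append_singleton t i ih =>
    rcases List.eq_nil_or_concat 𝒴 with rfl | ⟨𝒴, Y, rfl⟩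
    · simp at h𝒴
    rw [List.concat_eq_append] at h𝒴 ⊢
    have hlen : 𝒴.length = t.length := by simpa using h𝒴
    rw [← List.append_assoc] at hsip ⊢
    have hsip' : SIP (q ++ t) := SIP.of_append (u := []) hsip
    obtain ⟨r, hr⟩ := ih (fun j hj => hrq j (by simp [hj])) hsip' 𝒴 hlen
    have ht := (hsip'.append_singleton_iff i).2 hsip
    have hik := hrq i (by simp)
    rw [elementaryProd_append k hlen.symm, elementaryProd_singleton]
    have hg : GenericAssignment (t ++ [i]) (𝒴 ++ [Y]) →
        GenericAssignment t 𝒴 ∧ Y ≠ 0 ∧ (i = 0 → Y ≠ 1) := by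
      intro h
      unfold GenericAssignment at h
      rw [List.zip_append hlen.symm] at h
      exact ⟨fun z hz => h z (by simp [hz]), h (i, Y) (by simp)⟩
    rcases Nat.eq_zero_or_pos i with rfl | hi
    · refine ⟨r, hr.scale (c := ⟨k - 1, by omega⟩) hm (by simp; omega) ht Y
        (fun h => ⟨(hg h).1, (hg h).2.1, (hg h).2.2 rfl⟩) ?_⟩
      intro a b
      simp only [Matrix.submatrix_apply]
      split_ifs with h
      · rw [mul_elementary_col_last _ _ (by rw [h]; simp; omega)]
      · rw [Fin.ext_iff] at h
        have := (r b).2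
        simp only at h
        rw [mul_elementary_col_of_ne _ _ (by omega) (by omega)]
    · have hc : ((⟨k - 1 - i, by omega⟩ : Fin k) : ℕ) + i + 1 = k := by simp; omega
      have hd : ((⟨k - i, by omega⟩ : Fin k) : ℕ) + i = k := by simp; omega
      refine ⟨_, hr.swap hik hc hd ht Y (fun h => ⟨(hg h).1, (hg h).2.1⟩) ?_ ?_ ?_⟩
      · intro a
        simp only [Matrix.submatrix_apply, Equiv.trans_apply, Equiv.apply_symm_apply,
          Equiv.swap_apply_left]
        exact mul_elementary_col_snd _ _ hc hd _
      · intro a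
        simp only [Matrix.submatrix_apply, Equiv.trans_apply, Equiv.apply_symm_apply,
          Equiv.swap_apply_right]
        exact mul_elementary_col_fst _ _ hc hd _
      · intro a b h1 h2
        simp only [Matrix.submatrix_apply, Equiv.trans_apply,
          Equiv.swap_apply_of_ne_of_ne h1 h2]
        rw [Ne, Fin.ext_iff] at h1 h2
        exact mul_elementary_col_of_ne _ _ (by simp only at h1; omega) (by simp only at h2; omega) _

end

section
variable {F : Type*} [Field F] {n : ℕ}

/-! ### Transposition and commutation of elementary matrices -/

/-- The ordinary transpose of a constant matrix given by blocks. -/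
def constTranspose {a b : ℕ} (B : BlockMat F n a b) : BlockMat F n b a :=
  fun i j => (B j i).transpose

theorem constTranspose_mul {a b c : ℕ} (A : BlockMat F n a b) (B : BlockMat F n b c) :
    constTranspose (A * B) = constTranspose B * constTranspose A := by
  ext1 i j
  simp only [constTranspose, Matrix.mul_apply, Matrix.transpose_sum, Matrix.transpose_mul]

theorem constTranspose_one {k : ℕ} : constTranspose (1 : BlockMat F n k k) = 1 := by
  ext1 i j
  simp only [constTranspose, Matrix.one_apply]
  split_ifs <;> simp_all

theorem constTranspose_elementary (k i : ℕ) (B : Matrix (Fin n) (Fin n) F) :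
    constTranspose (elementary k i B) = elementary k i B.transpose := by
  ext1 a b
  simp only [constTranspose, elementary, Fin.ext_iff]
  split_ifs <;> first | rfl | (exfalso; omega) | simp

theorem constTranspose_elementaryProd (k : ℕ) (t : List ℕ) (𝒳 : List (Matrix (Fin n) (Fin n) F))
    (h : 𝒳.length = t.length) :
    constTranspose (elementaryProd k t 𝒳) =
      elementaryProd k t.reverse (𝒳.reverse.map Matrix.transpose) := by
  induction t generalizing 𝒳 with
  | nil => simp [elementaryProd, constTranspose_one]
  | cons i t ih =>
    rcases 𝒳 with _ | ⟨B, 𝒳⟩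
    · simp at h
    · have h' : 𝒳.length = t.length := by simpa using h
      rw [List.reverse_cons, List.reverse_cons, List.map_append,
        elementaryProd_append k (by simp [h']), ← ih 𝒳 h', List.map_singleton,
        elementaryProd_singleton, ← constTranspose_elementary, ← constTranspose_mul]
      simp [elementaryProd]

theorem elementary_mul_elementary_apply {k i j : ℕ} (hij : i + 2 ≤ j ∨ j + 2 ≤ i) (hi : i < k)
    (B C : Matrix (Fin n) (Fin n) F) (x y : Fin k) (h1 : (y : ℕ) + j + 1 ≠ k)
    (h2 : (y : ℕ) + j ≠ k) :
    (elementary k j C * elementary k i B) x y = elementary k i B x y := by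
  have hy := y.2
  by_cases hc : (y : ℕ) + i + 1 = k
  · rcases Nat.eq_zero_or_pos i with rfl | hi0
    · rw [mul_elementary_col_last _ _ (by omega), elementary_apply_col_of_ne _ h1 h2,
        elementary_apply_col_fst (i := 0) _ hc, if_neg (show (x : ℕ) ≠ y + 1 by have := x.2; omega)]
      simp
    · have hd : ((⟨y + 1, by omega⟩ : Fin k) : ℕ) + i = k := by simp; omega
      rw [mul_elementary_col_fst _ _ hc hd, elementary_apply_col_of_ne _ h1 h2,
        elementary_apply_col_of_ne _ (by simp; omega) (by simp; omega),
        elementary_apply_col_fst _ hc]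
      simp only [Fin.ext_iff]
      split_ifs <;> first | (exfalso; omega) | simp
  · by_cases hd : (y : ℕ) + i = k
    · have hc' : ((⟨y - 1, by omega⟩ : Fin k) : ℕ) + i + 1 = k := by simp; omega
      rw [mul_elementary_col_snd _ _ hc' hd, elementary_apply_col_of_ne _ (by simp; omega)
        (by simp; omega), elementary_apply_col_snd _ hd]
      simp only [Fin.ext_iff]
      split_ifs <;> first | rfl | (exfalso; omega)
    · rw [mul_elementary_col_of_ne _ _ hc hd, elementary_apply_col_of_ne _ h1 h2,
        elementary_apply_col_of_ne _ hc hd]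

/-- The two factors act on disjoint sets of columns, so every column is left alone by at least one
of them and the previous lemma applies in one of its two roles. -/
theorem elementary_commute {k i j : ℕ} (hij : i + 2 ≤ j) (hj : j < k)
    (B C : Matrix (Fin n) (Fin n) F) : Commute (elementary k i B) (elementary k j C) := by
  ext1 x y
  by_cases h : (y : ℕ) + j + 1 ≠ k ∧ (y : ℕ) + j ≠ k
  · rw [elementary_mul_elementary_apply (.inl hij) (by omega) B C x y h.1 h.2,
      mul_elementary_col_of_ne _ _ h.1 h.2]
  · have h1 : (y : ℕ) + i + 1 ≠ k := by omega
    have h2 : (y : ℕ) + i ≠ k := by omega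
    rw [elementary_mul_elementary_apply (.inr hij) hj C B x y h1 h2,
      mul_elementary_col_of_ne _ _ h1 h2]

theorem elementaryProd_commute {k j : ℕ} (hj : j < k) (C : Matrix (Fin n) (Fin n) F)
    (t : List ℕ) (ht : ∀ i ∈ t, i + 2 ≤ j) (𝒳 : List (Matrix (Fin n) (Fin n) F)) :
    Commute (elementaryProd k t 𝒳) (elementary k j C) := by
  induction t generalizing 𝒳 with
  | nil => simp [elementaryProd]
  | cons i t ih =>
    rcases 𝒳 with _ | ⟨B, 𝒳⟩
    · simp [elementaryProd]
    · have := (elementary_commute (ht i (by simp)) hj B C).mul_left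
        (ih (fun i hi => ht i (by simp [hi])) 𝒳)
      simpa [elementaryProd] using this

/-! ### Extension of a block-matrix by an identity block -/

/-- The block-matrix `I_n ⊕ M`. -/
def oneOplus {k : ℕ} (M : BlockMat F n k k) : BlockMat F n (k + 1) (k + 1) :=
  fun x y => Fin.cases (Fin.cases 1 (fun _ => 0) y) (fun x => Fin.cases 0 (fun y => M x y) y) x

section
variable {k : ℕ} (M N : BlockMat F n k k) (x y : Fin k)
@[simp] theorem oneOplus_zero_zero : oneOplus M 0 0 = 1 := rfl
@[simp] theorem oneOplus_zero_succ : oneOplus M 0 y.succ = 0 := rfl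
@[simp] theorem oneOplus_succ_zero : oneOplus M x.succ 0 = 0 := rfl
@[simp] theorem oneOplus_succ_succ : oneOplus M x.succ y.succ = M x y := rfl

theorem oneOplus_mul : oneOplus (M * N) = oneOplus M * oneOplus N := by
  ext1 x y
  rw [Matrix.mul_apply, Fin.sum_univ_succ]
  cases x using Fin.cases <;> cases y using Fin.cases <;> simp [Matrix.mul_apply]

theorem oneOplus_one : oneOplus (1 : BlockMat F n k k) = 1 := by
  ext1 x y
  cases x using Fin.cases <;> cases y using Fin.cases <;>
    simp [Matrix.one_apply, eq_comm]
end

theorem elementary_succ {k i : ℕ} (hi : i < k) (B : Matrix (Fin n) (Fin n) F) :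
    elementary (k + 1) i B = oneOplus (elementary k i B) := by
  ext1 x y
  cases x using Fin.cases <;> cases y using Fin.cases <;>
    simp [elementary, Fin.ext_iff] <;> split_ifs <;> first | rfl | (exfalso; omega)

theorem elementaryProd_succ {k : ℕ} (t : List ℕ) (ht : ∀ i ∈ t, i < k)
    (𝒳 : List (Matrix (Fin n) (Fin n) F)) :
    elementaryProd (k + 1) t 𝒳 = oneOplus (elementaryProd k t 𝒳) := by
  induction t generalizing 𝒳 with
  | nil => simp [elementaryProd, oneOplus_one]
  | cons i t ih =>
    rcases 𝒳 with _ | ⟨B, 𝒳⟩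
    · simp [elementaryProd, oneOplus_one]
    · have := ih (fun i hi => ht i (by simp [hi])) 𝒳
      simp only [elementaryProd, List.zipWith_cons_cons, List.prod_cons] at this ⊢
      rw [this, elementary_succ (ht i (by simp)), oneOplus_mul]

/-- The permutation sending `a` to `b` that acts as `σ` on the remaining elements. -/
def insertPerm {k : ℕ} (a b : Fin (k + 1)) (σ : Equiv.Perm (Fin k)) : Equiv.Perm (Fin (k + 1)) :=
  ((finSuccEquiv' a).trans (Equiv.optionCongr σ)).trans (finSuccEquiv' b).symm

theorem insertPerm_self {k : ℕ} (a b : Fin (k + 1)) (σ : Equiv.Perm (Fin k)) :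
    insertPerm a b σ a = b := by
  simp [insertPerm]

theorem insertPerm_succAbove {k : ℕ} (a b : Fin (k + 1)) (σ : Equiv.Perm (Fin k)) (x : Fin k) :
    insertPerm a b σ (a.succAbove x) = b.succAbove (σ x) := by
  simp [insertPerm]

/-! ### Fiedler pencils -/

/-- The pencil `λ D - M` is an extended block Kronecker pencil up to block-permutations, where
`σ` and `τ` give the new positions of the block-rows and of the block-columns, its wing
block-rows and block-columns are those of the Kronecker pencil, and `t` is the tuple of the
pencil. -/
structure IsFiedlerForm (k p q : ℕ) (A : ℕ → Matrix (Fin n) (Fin n) F) (t : List ℕ)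
    (σ τ : Equiv.Perm (Fin k)) (D M : BlockMat F n k k) : Prop where
  add_eq : p + q + 1 = k
  row_zero : ∀ i : Fin k, (i : ℕ) = 0 → σ i = i
  col_zero : ∀ i : Fin k, (i : ℕ) = 0 → τ i = i
  row_wing : ∀ x : Fin k, q + 1 ≤ (σ x : ℕ) ↔ ¬ IsHead t.reverse (k - 1 - x)
  col_wing : ∀ y : Fin k, p + 1 ≤ (τ y : ℕ) ↔ ¬ IsHead t (k - 1 - y)
  D_row : ∀ x y : Fin k, q + 1 ≤ (σ x : ℕ) → D x y = if (τ y : ℕ) + q = σ x then 1 else 0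
  M_row : ∀ x y : Fin k, q + 1 ≤ (σ x : ℕ) → M x y = if (τ y : ℕ) + q + 1 = σ x then 1 else 0
  D_col : ∀ x y : Fin k, p + 1 ≤ (τ y : ℕ) → D x y = if (σ x : ℕ) + p = τ y then 1 else 0
  M_col : ∀ x y : Fin k, p + 1 ≤ (τ y : ℕ) → M x y = if (σ x : ℕ) + p + 1 = τ y then 1 else 0
  D_zero : ∀ x : Fin k, (x : ℕ) = 0 → D x x = A k
  M_zero : ∀ x : Fin k, (x : ℕ) = 0 → M x x = -A (k - 1)
  -- The AS condition of the body in the new positions; the minus sign comes from λD - M.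
  sum_eq : ∀ s ≤ k, ∑ x : Fin k, ∑ y : Fin k, (if (σ x : ℕ) ≤ q ∧ (τ y : ℕ) ≤ p then
    (if (σ x : ℕ) + τ y + s = k then D x y else 0) -
      (if (σ x : ℕ) + τ y + s + 1 = k then M x y else 0) else 0) = A s

theorem IsFiedlerForm.transpose {k p q : ℕ} {A : ℕ → Matrix (Fin n) (Fin n) F} {t : List ℕ}
    {σ τ : Equiv.Perm (Fin k)} {D M : BlockMat F n k k} (h : IsFiedlerForm k p q A t σ τ D M) :
    IsFiedlerForm k q p (fun i => (A i).transpose) t.reverse τ σ (constTranspose D)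
      (constTranspose M) := by
  obtain ⟨h1, h2, h3, h4, h5, h6, h7, h8, h9, h10, h11, h12⟩ := h
  refine ⟨by omega, h3, h2, by simpa using h5, h4, ?_, ?_, ?_, ?_, ?_, ?_, ?_⟩
  · intro x y h
    simp only [constTranspose, h8 _ _ h]
    split_ifs <;> simp
  · intro x y h
    simp only [constTranspose, h9 _ _ h]
    split_ifs <;> simp
  · intro x y h
    simp only [constTranspose, h6 _ _ h]
    split_ifs <;> simp
  · intro x y h
    simp only [constTranspose, h7 _ _ h]
    split_ifs <;> simp
  · intro x hx
    simp only [constTranspose, h10 x hx]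
  · intro x hx
    simp only [constTranspose, h11 x hx, Matrix.transpose_neg]
  · intro s hs
    rw [← h12 s hs, Finset.sum_comm]
    simp only [Matrix.transpose_sum]
    refine Finset.sum_congr rfl fun x _ => Finset.sum_congr rfl fun y _ => ?_
    simp only [constTranspose, add_comm (τ y : ℕ), and_comm (a := (τ y : ℕ) ≤ p)]
    split_ifs <;> simp

/-- Through `τ`, the heads correspond to the body block-columns, which occupy the positions 0, …, p.
-/
theorem IsFiedlerForm.headCount_eq {k p q : ℕ} {A : ℕ → Matrix (Fin n) (Fin n) F} {t : List ℕ}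
    {σ τ : Equiv.Perm (Fin k)} {D M : BlockMat F n k k} (h : IsFiedlerForm k p q A t σ τ D M)
    (ht : SIP t) (htk : ∀ i ∈ t, i < k) : headCount t = p + 1 := by
  have hk := h.add_eq
  rw [headCount, ht.heads_eq]
  refine Set.ncard_eq_of_bijective (fun b hb => k - 1 - (τ.symm ⟨b, by omega⟩ : Fin k)) ?_ ?_ ?_
  · intro j hj
    have hjk := htk j (IsHead.mem hj)
    have h1 := h.col_wing ⟨k - 1 - j, by omega⟩
    simp only [show k - 1 - (k - 1 - j) = j by omega] at h1
    refine ⟨τ ⟨k - 1 - j, by omega⟩, ?_, ?_⟩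
    · by_contra hc
      exact h1.1 (by omega) hj
    · simp; omega
  · intro b hb
    have h1 := h.col_wing (τ.symm ⟨b, by omega⟩)
    simp only [Equiv.apply_symm_apply] at h1
    by_contra hc
    have := h1.2 hc
    omega
  · intro a b ha hb hab
    have h1 := (τ.symm ⟨a, by omega⟩ : Fin k).2
    have h2 := (τ.symm ⟨b, by omega⟩ : Fin k).2
    have : (τ.symm ⟨a, by omega⟩ : Fin k) = τ.symm ⟨b, by omega⟩ := Fin.ext (by omega)
    simpa using this

/-- The block-matrix `diag(A_k, I_n, …, I_n)`. -/
def leadingDiag (k : ℕ) (A : ℕ → Matrix (Fin n) (Fin n) F) : BlockMat F n k k :=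
  Matrix.diagonal fun a => if (a : ℕ) = 0 then A k else 1

theorem constTranspose_leadingDiag (k : ℕ) (A : ℕ → Matrix (Fin n) (Fin n) F) :
    constTranspose (leadingDiag k A) = leadingDiag k fun i => (A i).transpose := by
  ext1 x y
  simp only [constTranspose, leadingDiag, Matrix.diagonal_apply]
  split_ifs <;> simp_all

theorem isHead_middle_iff {u v : List ℕ} {m j : ℕ} (h : j + 1 < m) :
    IsHead (u ++ m :: v) j ↔ IsHead (u ++ v) j := by
  unfold IsHead
  rw [List.filter_append, List.filter_append,
    List.filter_cons_of_neg (by simp; omega)]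

/-- The new largest index k + 1 stands to the right of k. The new block-row 0 becomes the first body
row, and block-column 1, which is λe_1 - e_0, becomes the first wing column, at position p + 1. Body
rows move down by one while the grade grows by one, so the old antidiagonals are preserved. -/
theorem IsFiedlerForm.succ {k p q : ℕ} {A : ℕ → Matrix (Fin n) (Fin n) F} {u v : List ℕ}
    {σ τ : Equiv.Perm (Fin (k + 1))} {M : BlockMat F n (k + 1) (k + 1)}
    (h : IsFiedlerForm (k + 1) p q A (u ++ v) σ τ (leadingDiag (k + 1) A) M)
    (hu : ∀ i ∈ u, i < k + 1) (hv : ∀ i ∈ v, i < k) (hk : k ∈ u) (hp : p + 1 < k + 2) :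
    IsFiedlerForm (k + 2) p (q + 1) A (u ++ (k + 1) :: v) (insertPerm 0 0 σ)
      (insertPerm 1 ⟨p + 1, hp⟩ τ) (leadingDiag (k + 2) A)
      (oneOplus M * elementary (k + 2) (k + 1) (-A (k + 1))) := by
  have hadd := h.add_eq
  have hσ0 : insertPerm 0 0 σ 0 = 0 := insertPerm_self 0 0 σ
  have hσs : ∀ x, ((insertPerm 0 0 σ x.succ : Fin (k + 2)) : ℕ) = σ x + 1 := fun x => by
    have := insertPerm_succAbove 0 0 σ x
    simp only [Fin.zero_succAbove] at this
    rw [this, Fin.val_succ]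
  have hτ1 : ((insertPerm 1 ⟨p + 1, hp⟩ τ 1 : Fin (k + 2)) : ℕ) = p + 1 := by
    rw [insertPerm_self]
  have hτs : ∀ y, ((insertPerm 1 ⟨p + 1, hp⟩ τ (Fin.succAbove 1 y) : Fin (k + 2)) : ℕ) =
      if (τ y : ℕ) ≤ p then (τ y : ℕ) else τ y + 1 := fun y => by
    rw [insertPerm_succAbove]
    simp only [Fin.succAbove, Fin.lt_def, Fin.val_castSucc, apply_ite Fin.val, Fin.val_succ,
      Nat.lt_succ_iff]
  generalize insertPerm 0 0 σ = σ' at *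
  generalize insertPerm 1 ⟨p + 1, hp⟩ τ = τ' at *
  have hτ00 : (τ 0 : ℕ) = 0 := by rw [h.col_zero 0 rfl]; rfl
  have hσ00 : (σ 0 : ℕ) = 0 := by rw [h.row_zero 0 rfl]; rfl
  have hσne : ∀ x, x ≠ 0 → (σ x : ℕ) ≠ 0 := fun x hx e =>
    hx (σ.injective (Fin.ext (by rw [e, hσ00])))
  have hτne : ∀ x, x ≠ 0 → (τ x : ℕ) ≠ 0 := fun x hx e =>
    hx (τ.injective (Fin.ext (by rw [e, hτ00])))
  have hsA0 : Fin.succAbove (1 : Fin (k + 2)) 0 = 0 := rfl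
  have hsAs : ∀ y : Fin k, Fin.succAbove (1 : Fin (k + 2)) y.succ = y.succ.succ := fun y => by
    rw [Fin.succAbove, if_neg]
    simp [Fin.lt_def]
  -- the entries of the new matrices
  have hD01 : leadingDiag (k + 2) A 0 1 = 0 := by simp [leadingDiag]
  have hDs1 : ∀ x, leadingDiag (k + 2) A (Fin.succ x) 1 = if x = 0 then 1 else 0 := by
    intro x
    rw [leadingDiag, Matrix.diagonal_apply]
    simp only [Fin.ext_iff, Fin.val_succ, Fin.val_one, Fin.val_zero]
    split_ifs <;> first | rfl | (exfalso; omega)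
  have hD0 : ∀ y, leadingDiag (k + 2) A 0 (Fin.succAbove 1 y) =
      if y = 0 then A (k + 2) else 0 := by
    intro y
    cases y using Fin.cases with
    | zero => simp [leadingDiag]
    | succ y =>
      rw [leadingDiag, Matrix.diagonal_apply, hsAs]
      simp only [Fin.ext_iff, Fin.val_succ, Fin.val_zero]
      split_ifs <;> rfl
  -- The old corner A_{k+1} disappears from the coefficient of λ; it returns in the constant term,
  -- through the corner of `M'`.
  have hDs : ∀ x y, leadingDiag (k + 2) A (Fin.succ x) (Fin.succAbove 1 y) =
      leadingDiag (k + 1) A x y - if x = 0 ∧ y = 0 then A (k + 1) else 0 := by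
    intro x y
    rw [leadingDiag, Matrix.diagonal_apply, leadingDiag, Matrix.diagonal_apply]
    cases y using Fin.cases with
    | zero =>
      rw [hsA0]
      simp only [Fin.ext_iff, Fin.val_succ, Fin.val_zero, and_true]
      split_ifs <;> first | (exfalso; omega) | simp
    | succ y =>
      rw [hsAs]
      simp only [Fin.ext_iff, Fin.val_succ, Fin.val_zero, Nat.succ_ne_zero, and_false]
      split_ifs <;> first | (exfalso; omega) | simp
  have e0 : ((0 : Fin (k + 2)) : ℕ) + (k + 1) + 1 = k + 2 := by simp
  have e1 : ((1 : Fin (k + 2)) : ℕ) + (k + 1) = k + 2 := by simp; omega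
  set M' := oneOplus M * elementary (k + 2) (k + 1) (-A (k + 1)) with hM'
  have hM1 : ∀ x, M' x 1 = if x = 0 then 1 else 0 := by
    intro x
    rw [hM', mul_elementary_col_snd _ _ e0 e1]
    cases x using Fin.cases <;> simp
  have hM0 : ∀ y, M' 0 (Fin.succAbove 1 y) = if y = 0 then -A (k + 1) else 0 := by
    intro y
    cases y using Fin.cases with
    | zero =>
      rw [hsA0, hM', mul_elementary_col_fst _ _ e0 e1]
      have : oneOplus M 0 1 = 0 := oneOplus_zero_succ M 0
      simp [this]
    | succ y =>
      rw [hsAs, hM', mul_elementary_col_of_ne _ _ (by simp) (by simp; omega)]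
      simp
  have hMs : ∀ x y, M' (Fin.succ x) (Fin.succAbove 1 y) = M x y := by
    intro x y
    cases y using Fin.cases with
    | zero =>
      rw [hsA0, hM', mul_elementary_col_fst _ _ e0 e1]
      have : oneOplus M x.succ 1 = M x 0 := oneOplus_succ_succ M x 0
      simp [this]
    | succ y =>
      rw [hsAs, hM', mul_elementary_col_of_ne _ _ (by simp) (by simp; omega)]
      simp
  clear_value M'
  have hmax : ∀ t : List ℕ, (k + 1) ∈ t → (∀ i ∈ t, i ∈ u ++ (k + 1) :: v) →
      IsHead t (k + 1) := by
    intro t ht hi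
    refine isHead_of_max ht fun h => ?_
    have := hi _ h
    simp only [List.mem_append, List.mem_cons] at this
    rcases this with h | h | h
    · have := hu _ h; omega
    · omega
    · have := hv _ h; omega
  refine ⟨by omega, ?_, ?_, ?_, ?_, ?_, ?_, ?_, ?_, ?_, ?_, ?_⟩
  · intro i hi
    have : i = 0 := Fin.ext hi
    rw [this, hσ0]
  · intro i hi
    have : i = Fin.succAbove 1 0 := Fin.ext hi
    refine Fin.ext ?_
    rw [this, hτs, hτ00]
    simp
  · intro x
    cases x using Fin.cases with
    | zero =>
      rw [hσ0]
      refine iff_of_false (by simp) (not_not.2 ?_)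
      exact hmax _ (by simp) (by simp; tauto)
    | succ x =>
      rw [hσs]
      cases x using Fin.cases with
      | zero =>
        rw [hσ00]
        refine iff_of_false (by simp) (not_not.2 ?_)
        simp only [Fin.succ_zero_eq_one, Fin.val_one, List.reverse_append, List.reverse_cons, List.append_assoc, List.singleton_append]
        rw [show k + 2 - 1 - 1 = k by omega, isHead_append_of_mem (by simp [hk]),
          ← List.singleton_append, isHead_append_of_mem (by simp [hk])]
        refine isHead_of_max (by simp [hk]) fun h => ?_
        have := hu _ (by simpa using h)
        omega
      | succ x =>
        have := h.row_wing x.succ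
        rw [Nat.add_le_add_iff_right, this, not_iff_not]
        simp only [List.reverse_append, List.reverse_cons, List.append_assoc,
          List.singleton_append, Fin.val_succ]
        rw [isHead_middle_iff (by omega),
          show k + 2 - 1 - ((x : ℕ) + 1 + 1) = k + 1 - 1 - (x + 1) by omega]
  · intro y
    rcases Fin.eq_self_or_eq_succAbove 1 y with rfl | ⟨y, rfl⟩
    · rw [hτ1]
      refine iff_of_true le_rfl ?_
      simp only [Fin.val_one]
      rw [show k + 2 - 1 - 1 = k by omega, isHead_append]
      rintro (h | ⟨-, h, -⟩)
      · have := h.mem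
        simp only [List.mem_cons] at this
        rcases this with h | h
        · omega
        · have := hv _ h; omega
      · simp at h
    · have : p + 1 ≤ ((τ' (Fin.succAbove 1 y) : Fin (k + 2)) : ℕ) ↔ p + 1 ≤ (τ y : ℕ) := by
        rw [hτs]; split_ifs <;> omega
      rw [this]
      cases y using Fin.cases with
      | zero =>
        rw [hτ00]
        refine iff_of_false (by simp) (not_not.2 ?_)
        exact hmax _ (by simp) (by simp)
      | succ y =>
        rw [h.col_wing, not_iff_not, hsAs]
        simp only [Fin.val_succ]
        rw [isHead_middle_iff (by omega), show k + 2 - 1 - ((y : ℕ) + 1 + 1) = k + 1 - 1 - (y + 1) by omega]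
  · intro x y hx
    cases x using Fin.cases with
    | zero => rw [hσ0] at hx; simp at hx
    | succ x =>
      rw [hσs] at hx ⊢
      have hx0 : x ≠ 0 := by rintro rfl; omega
      have := (σ x).2
      rcases Fin.eq_self_or_eq_succAbove 1 y with rfl | ⟨y, rfl⟩
      · rw [hDs1, if_neg hx0, hτ1, if_neg (by omega)]
      · rw [hDs, h.D_row x y (by omega), if_neg (c := x = 0 ∧ y = 0) (by tauto), sub_zero, hτs]
        refine if_congr ?_ rfl rfl
        split_ifs <;> omega
  · intro x y hx
    cases x using Fin.cases with
    | zero => rw [hσ0] at hx; simp at hx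
    | succ x =>
      rw [hσs] at hx ⊢
      have := (σ x).2
      rcases Fin.eq_self_or_eq_succAbove 1 y with rfl | ⟨y, rfl⟩
      · rw [hM1, if_neg (Fin.succ_ne_zero _), hτ1, if_neg (by omega)]
      · rw [hMs, h.M_row x y (by omega), hτs]
        refine if_congr ?_ rfl rfl
        split_ifs <;> omega
  · intro x y hy
    rcases Fin.eq_self_or_eq_succAbove 1 y with rfl | ⟨y, rfl⟩
    · cases x using Fin.cases with
      | zero => rw [hσ0, hτ1, hD01]; simp
      | succ x =>
        rw [hDs1, hσs, hτ1]
        refine if_congr ⟨?_, fun h => ?_⟩ rfl rfl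
        · rintro rfl; omega
        · by_contra hx
          exact hσne x hx (by omega)
    · rw [hτs] at hy ⊢
      have hy' : ¬ (τ y : ℕ) ≤ p := fun hc => by rw [if_pos hc] at hy; omega
      have hy0 : y ≠ 0 := by rintro rfl; omega
      rw [if_neg hy']
      cases x using Fin.cases with
      | zero => rw [hσ0, hD0, if_neg hy0, if_neg (by simp; omega)]
      | succ x =>
        rw [hDs, hσs, h.D_col x y (by omega), if_neg (c := x = 0 ∧ y = 0) (by tauto), sub_zero]
        exact if_congr (by omega) rfl rfl
  · intro x y hy
    rcases Fin.eq_self_or_eq_succAbove 1 y with rfl | ⟨y, rfl⟩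
    · rw [hM1, hτ1]
      cases x using Fin.cases with
      | zero => rw [hσ0]; simp
      | succ x => rw [hσs, if_neg (Fin.succ_ne_zero _), if_neg (by omega)]
    · rw [hτs] at hy ⊢
      have hy' : ¬ (τ y : ℕ) ≤ p := fun hc => by rw [if_pos hc] at hy; omega
      have hy0 : y ≠ 0 := by rintro rfl; omega
      rw [if_neg hy']
      cases x using Fin.cases with
      | zero => rw [hσ0, hM0, if_neg hy0, if_neg (by simp; omega)]
      | succ x =>
        rw [hMs, hσs, h.M_col x y (by omega)]
        exact if_congr (by omega) rfl rfl
  · intro x hx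
    obtain rfl : x = 0 := Fin.ext hx
    simp [leadingDiag]
  · intro x hx
    obtain rfl : x = 0 := Fin.ext hx
    have := hM0 0
    rw [hsA0] at this
    rw [this, if_pos rfl]; rfl
  · intro s hs
    -- For s = k + 2 the antidiagonals of the smaller pencil are empty.
    have hold : ∑ x : Fin (k + 1), ∑ y : Fin (k + 1), (if (σ x : ℕ) ≤ q ∧ (τ y : ℕ) ≤ p then
        (if (σ x : ℕ) + τ y + s = k + 1 then leadingDiag (k + 1) A x y else 0) -
          (if (σ x : ℕ) + τ y + s + 1 = k + 1 then M x y else 0) else 0) =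
        if s = k + 2 then 0 else A s := by
      split_ifs with hsk
      · refine Finset.sum_eq_zero fun x _ => Finset.sum_eq_zero fun y _ => ?_
        rw [if_neg (c := (σ x : ℕ) + τ y + s = k + 1) (by omega), if_neg (c := _ = k + 1) (by omega)]
        simp
      · exact h.sum_eq s (by omega)
    rw [Fin.sum_univ_succ]
    simp only [Fin.sum_univ_succAbove _ (1 : Fin (k + 2))]
    simp only [hτ1, hτs, hσ0, hσs, hD0, hDs, hM0, hMs, Nat.add_le_add_iff_right]
    rw [Finset.sum_eq_single (0 : Fin (k + 1)) (by intro y _ hy; simp [hy]) (by simp)]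
    have hterm : ∀ x y : Fin (k + 1),
        (if (σ x : ℕ) ≤ q ∧ (if (τ y : ℕ) ≤ p then (τ y : ℕ) else τ y + 1) ≤ p then
        (if (σ x : ℕ) + 1 + (if (τ y : ℕ) ≤ p then (τ y : ℕ) else τ y + 1) + s = k + 2 then
          leadingDiag (k + 1) A x y - (if x = 0 ∧ y = 0 then A (k + 1) else 0) else 0) -
          (if (σ x : ℕ) + 1 + (if (τ y : ℕ) ≤ p then (τ y : ℕ) else τ y + 1) + s + 1 = k + 2 then
            M x y else 0) else 0) =
        (if (σ x : ℕ) ≤ q ∧ (τ y : ℕ) ≤ p then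
        (if (σ x : ℕ) + τ y + s = k + 1 then leadingDiag (k + 1) A x y else 0) -
          (if (σ x : ℕ) + τ y + s + 1 = k + 1 then M x y else 0) else 0) -
        if x = 0 then (if y = 0 then (if s = k + 1 then A (k + 1) else 0) else 0) else 0 := by
      intro x y
      by_cases hy : (τ y : ℕ) ≤ p
      · simp only [hy, if_true, and_true]
        have e1 : (σ x : ℕ) + 1 + τ y + s = k + 2 ↔ (σ x : ℕ) + τ y + s = k + 1 := by omega
        have e2 : (σ x : ℕ) + 1 + τ y + s + 1 = k + 2 ↔ (σ x : ℕ) + τ y + s + 1 = k + 1 := by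
          omega
        simp only [e1, e2]
        by_cases hxy : x = 0 ∧ y = 0
        · obtain ⟨rfl, rfl⟩ := hxy
          simp only [hσ00, hτ00, Nat.zero_le, zero_add, if_true, and_self]
          split_ifs <;> simp [sub_right_comm]
        · have : (if x = 0 then (if y = 0 then (if s = k + 1 then A (k + 1) else 0) else 0)
              else 0) = 0 := by
            split_ifs <;> first | rfl | (exfalso; tauto)
          rw [this, if_neg hxy, sub_zero, sub_zero]
      · have hy0 : y ≠ 0 := by rintro rfl; omega
        simp [hy, hy0]
        omega
    simp only [hterm]
    simp only [Finset.sum_sub_distrib, Finset.sum_add_distrib]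
    have hs1 : ∀ x : Fin (k + 1), (if (σ x : ℕ) ≤ q ∧ p + 1 ≤ p then
        ((if (σ x : ℕ) + 1 + (p + 1) + s = k + 2 then
          leadingDiag (k + 2) A x.succ 1 else 0) -
          (if (σ x : ℕ) + 1 + (p + 1) + s + 1 = k + 2 then M' x.succ 1 else 0)) else 0) = 0 :=
      fun x => if_neg (by omega)
    simp only [hs1, Finset.sum_const_zero, zero_add, hold]
    rw [if_neg (by omega)]
    simp only [hτ00, Fin.val_zero, Nat.zero_le, if_true, and_self, zero_add]
    simp
    split_ifs <;> first | (exfalso; omega) | (subst_vars; simp)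

theorem isFiedlerForm_one (A : ℕ → Matrix (Fin n) (Fin n) F) :
    IsFiedlerForm 1 0 0 A [0] 1 1 (leadingDiag 1 A) (elementary 1 0 (-A 0)) := by
  have hh : IsHead [0] 0 := by simp [IsHead]
  have he : elementary 1 0 (-A 0) 0 0 = -A 0 := by simp [elementary]
  have hd : leadingDiag 1 A 0 0 = A 1 := by simp [leadingDiag]
  refine ⟨rfl, fun _ _ => rfl, fun _ _ => rfl, ?_, ?_, ?_, ?_, ?_, ?_, ?_, ?_, ?_⟩
  · intro x; simp [hh]
  · intro x; simp [hh]
  · intro x y hx; simp at hx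
  · intro x y hx; simp at hx
  · intro x y hx; simp at hx
  · intro x y hx; simp at hx
  · intro x hx; obtain rfl : x = 0 := Fin.ext hx; exact hd
  · intro x hx; obtain rfl : x = 0 := Fin.ext hx; exact he
  · intro s hs
    simp only [Finset.univ_unique, Fin.default_eq_zero, Finset.sum_singleton]
    rw [he, hd]
    interval_cases s <;> simp

/-- Induction by removing the largest index. If it stands to the left of its predecessor, reversal
of the tuple and transposition lead to the other case. -/
theorem exists_isFiedlerForm (k : ℕ) (t : List ℕ) (ht : t.Perm (List.range (k + 1)))
    (A : ℕ → Matrix (Fin n) (Fin n) F) :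
    ∃ p q σ τ, IsFiedlerForm (k + 1) p q A t σ τ (leadingDiag (k + 1) A)
      (elementaryProd (k + 1) t (t.map fun i => -A i)) := by
  induction k generalizing t A with
  | zero =>
    obtain rfl : t = [0] := by simpa using ht
    refine ⟨0, 0, 1, 1, ?_⟩
    rw [List.map_singleton, elementaryProd_singleton]
    exact isFiedlerForm_one A
  | succ k ih =>
    have key : ∀ (u v : List ℕ) (A : ℕ → Matrix (Fin n) (Fin n) F),
        (u ++ (k + 1) :: v).Perm (List.range (k + 2)) → k ∈ u →
        ∃ p q σ τ, IsFiedlerForm (k + 2) p q A (u ++ (k + 1) :: v) σ τ (leadingDiag (k + 2) A)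
          (elementaryProd (k + 2) (u ++ (k + 1) :: v)
            ((u ++ (k + 1) :: v).map fun i => -A i)) := by
      intro u v A hp hk
      have hp' : (u ++ v).Perm (List.range (k + 1)) := by
        have h1 := List.perm_middle.symm.trans hp
        rw [List.range_succ] at h1
        exact (h1.trans (List.perm_append_singleton _ _)).cons_inv
      have hmem : ∀ i ∈ u ++ v, i < k + 1 := fun i hi => List.mem_range.1 (hp'.mem_iff.1 hi)
      have hnd : (u ++ v).Nodup := hp'.nodup_iff.2 List.nodup_range
      have hu : ∀ i ∈ u, i < k + 1 := fun i hi => hmem i (by simp [hi])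
      have hv : ∀ i ∈ v, i < k := by
        intro i hi
        have h1 := hmem i (by simp [hi])
        have h2 : i ≠ k := fun e => (List.disjoint_of_nodup_append hnd) hk (e ▸ hi)
        omega
      obtain ⟨p, q, σ, τ, h⟩ := ih (u ++ v) hp' A
      have hadd := h.add_eq
      have := h.succ hu hv hk (by omega)
      suffices e : elementaryProd (k + 2) (u ++ (k + 1) :: v)
          ((u ++ (k + 1) :: v).map fun i => -A i) =
          oneOplus (elementaryProd (k + 1) (u ++ v) ((u ++ v).map fun i => -A i)) *
            elementary (k + 2) (k + 1) (-A (k + 1)) by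
        rw [e]; exact ⟨_, _, _, _, this⟩
      rw [← elementaryProd_succ _ hmem, List.map_append, List.map_append, List.map_cons,
        elementaryProd_append _ (by simp), elementaryProd_append _ (by simp), mul_assoc]
      congr 1
      -- As k lies in `u`, all indices of `v` are below k and their factors commute with that of k +
      -- 1, which can be moved to the far right.
      rw [(elementaryProd_commute (by omega) _ v (fun i hi => by have := hv i hi; omega) _).eq]
      simp [elementaryProd]
    have hmem : k + 1 ∈ t := ht.mem_iff.2 (by simp)
    obtain ⟨u, v, rfl⟩ := List.append_of_mem hmem
    have hk : k ∈ u ++ (k + 1) :: v := ht.mem_iff.2 (by simp)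
    simp only [List.mem_append, List.mem_cons] at hk
    rcases hk with hk | hk | hk
    · exact key u v A ht hk
    · omega
    · have e : (u ++ (k + 1) :: v).reverse = v.reverse ++ (k + 1) :: u.reverse := by simp
      have hp : (v.reverse ++ (k + 1) :: u.reverse).Perm (List.range (k + 2)) := by
        rw [← e]; exact (List.reverse_perm _).trans ht
      obtain ⟨p, q, σ, τ, h⟩ := key v.reverse u.reverse (fun i => (A i).transpose) hp (by simpa)
      refine ⟨q, p, τ, σ, ?_⟩
      have h' := h.transpose
      rw [← e, List.reverse_reverse, constTranspose_leadingDiag,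
        constTranspose_elementaryProd _ _ _ (by simp), List.reverse_reverse] at h'
      simpa [Function.comp_def, List.map_reverse] using h'

end

section
variable {F : Type*} [Field F] {n : ℕ}

/-! ### Pencils with given coefficients -/

/-- The pencil `λ S₁ - S₀`. -/
noncomputable def pencilOf {a b : ℕ} (S₁ S₀ : BlockMat F n a b) : PolyBlockMat F n a b :=
  fun i j => (X : F[X]) • constPoly (S₁ i j) - constPoly (S₀ i j)

theorem constPoly_eq (B : Matrix (Fin n) (Fin n) F) :
    constPoly B = (C : F →+* F[X]).mapMatrix B := rfl

theorem constBlock_mul {a b c : ℕ} (A : BlockMat F n a b) (B : BlockMat F n b c) :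
    constBlock (A * B) = constBlock A * constBlock B :=
  Matrix.map_mul (f := ((C : F →+* F[X]).mapMatrix : Matrix (Fin n) (Fin n) F →+* _))

theorem pencilOf_eq {a b : ℕ} (S₁ S₀ : BlockMat F n a b) :
    pencilOf S₁ S₀ = (X : F[X]) • constBlock S₁ - constBlock S₀ := by
  ext1 i j; rfl

theorem constBlock_mul_pencilOf {a b c : ℕ} (A : BlockMat F n a b) (S₁ S₀ : BlockMat F n b c) :
    constBlock A * pencilOf S₁ S₀ = pencilOf (A * S₁) (A * S₀) := by
  rw [pencilOf_eq, pencilOf_eq, constBlock_mul, constBlock_mul, Matrix.mul_sub, Matrix.mul_smul]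

theorem pencilOf_mul_constBlock {a b c : ℕ} (S₁ S₀ : BlockMat F n a b) (A : BlockMat F n b c) :
    pencilOf S₁ S₀ * constBlock A = pencilOf (S₁ * A) (S₀ * A) := by
  rw [pencilOf_eq, pencilOf_eq, constBlock_mul, constBlock_mul, Matrix.sub_mul, Matrix.smul_mul]

theorem fullTranspose_pencilOf {a b : ℕ} (S₁ S₀ : BlockMat F n a b) :
    fullTranspose (pencilOf S₁ S₀) = pencilOf (constTranspose S₁) (constTranspose S₀) := by
  ext1 i j
  simp only [fullTranspose, pencilOf, constTranspose, Matrix.transpose_sub, Matrix.transpose_smul]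
  rfl

theorem matCoeff_pencilOf_one {a b : ℕ} (S₁ S₀ : BlockMat F n a b) (i : Fin a) (j : Fin b) :
    matCoeff (pencilOf S₁ S₀ i j) 1 = S₁ i j := by
  ext x y
  simp [matCoeff, pencilOf, constPoly, coeff_C]

theorem matCoeff_pencilOf_zero {a b : ℕ} (S₁ S₀ : BlockMat F n a b) (i : Fin a) (j : Fin b) :
    matCoeff (pencilOf S₁ S₀ i j) 0 = -S₀ i j := by
  ext x y
  simp [matCoeff, pencilOf, constPoly]

theorem isPencil_pencilOf {a b : ℕ} (S₁ S₀ : BlockMat F n a b) : IsPencil (pencilOf S₁ S₀) := by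
  intro i j x y
  simp only [pencilOf, constPoly, Matrix.sub_apply, Matrix.smul_apply, Matrix.map_apply,
    smul_eq_mul]
  refine (natDegree_sub_le _ _).trans (max_le ?_ (by simp))
  exact natDegree_mul_le.trans (by simp)

theorem transpose_blockPerm_mul {k m : ℕ} (l : Equiv.Perm (Fin k)) (L : PolyBlockMat F n k m) :
    (blockPerm F n l).transpose * L = L.submatrix l id := by
  ext1 i j
  rw [Matrix.mul_apply, Finset.sum_eq_single (l i)]
  · simp [blockPerm]
  · intro x _ hx
    simp [blockPerm, hx]
  · simp

theorem mul_blockPerm {k m : ℕ} (r : Equiv.Perm (Fin k)) (L : PolyBlockMat F n m k) :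
    L * blockPerm F n r = L.submatrix id r := by
  ext1 i j
  rw [Matrix.mul_apply, Finset.sum_eq_single (r j)]
  · simp [blockPerm]
  · intro x _ hx
    simp [blockPerm, hx]
  · simp

/-! ### The Kronecker pencil -/

/-- The coefficient of `λ` in the transpose of the Kronecker pencil. -/
def kronLead (F : Type*) [Field F] (n s : ℕ) : BlockMat F n (s + 1) s :=
  fun a i => if a = i.succ then 1 else 0

/-- The opposite of the constant coefficient of the transpose of the Kronecker pencil. -/
def kronConst (F : Type*) [Field F] (n s : ℕ) : BlockMat F n (s + 1) s :=
  fun a i => if a = i.castSucc then 1 else 0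

section
variable {s m : ℕ}

theorem kronLead_mul_zero (V : BlockMat F n s m) (b : Fin m) :
    (kronLead F n s * V) 0 b = 0 := by
  rw [Matrix.mul_apply]
  refine Finset.sum_eq_zero fun i _ => ?_
  rw [kronLead, if_neg (Fin.succ_ne_zero i).symm, zero_mul]

theorem kronLead_mul_succ (V : BlockMat F n s m) (a : Fin s) (b : Fin m) :
    (kronLead F n s * V) a.succ b = V a b := by
  rw [Matrix.mul_apply]
  simp [kronLead]

theorem kronConst_mul_last (V : BlockMat F n s m) (b : Fin m) :
    (kronConst F n s * V) (Fin.last s) b = 0 := by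
  rw [Matrix.mul_apply]
  refine Finset.sum_eq_zero fun i _ => ?_
  rw [kronConst, if_neg (Fin.castSucc_lt_last i).ne', zero_mul]

theorem kronConst_mul_castSucc (V : BlockMat F n s m) (a : Fin s) (b : Fin m) :
    (kronConst F n s * V) a.castSucc b = V a b := by
  rw [Matrix.mul_apply]
  simp [kronConst]

/-- The coefficient of λ contains V moved down by one row, and the constant one contains V in place.
The shift of one between the two antidiagonals makes the sums cancel. -/
theorem sum_antidiag_kron_mul (V : BlockMat F n s m) (t N : ℕ) :
    ∑ a : Fin (s + 1), ∑ b : Fin m,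
      ((if (a : ℕ) + b + t = N then (kronLead F n s * V) a b else 0) -
        (if (a : ℕ) + b + t + 1 = N then (kronConst F n s * V) a b else 0)) = 0 := by
  simp only [Finset.sum_sub_distrib]
  rw [Fin.sum_univ_succ, Fin.sum_univ_castSucc]
  simp only [kronLead_mul_zero, kronLead_mul_succ, kronConst_mul_last, kronConst_mul_castSucc,
    Fin.val_succ, Fin.val_castSucc, ite_self, Finset.sum_const_zero, zero_add, add_zero]
  rw [sub_eq_zero]
  refine Finset.sum_congr rfl fun a _ => Finset.sum_congr rfl fun b _ => ?_
  exact if_congr (by omega) rfl rfl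

omit [Field F] in
theorem constTranspose_constTranspose {a b : ℕ} (B : BlockMat F n a b) :
    constTranspose (constTranspose B) = B := by
  ext1 i j; simp [constTranspose]

theorem sum_antidiag_mul_kron (V : BlockMat F n m s) (t N : ℕ) :
    ∑ a : Fin m, ∑ b : Fin (s + 1),
      ((if (a : ℕ) + b + t = N then (V * constTranspose (kronLead F n s)) a b else 0) -
        (if (a : ℕ) + b + t + 1 = N then (V * constTranspose (kronConst F n s)) a b else 0)) =
      0 := by
  have h := sum_antidiag_kron_mul (constTranspose V) t N
  have h' := congrArg Matrix.transpose h
  rw [Finset.sum_comm] at h'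
  simp only [Matrix.transpose_sum, Matrix.transpose_zero] at h'
  refine Eq.trans ?_ h'
  refine Finset.sum_congr rfl fun a _ => Finset.sum_congr rfl fun b _ => ?_
  have key : ∀ K : BlockMat F n (s + 1) s,
      (V * constTranspose K) a b = ((K * constTranspose V) b a).transpose := by
    intro K
    have := constTranspose_mul K (constTranspose V)
    rw [constTranspose_constTranspose] at this
    rw [← this]; rfl
  rw [key, key, add_comm (b : ℕ)]
  split_ifs <;> simp

theorem isWingPencil_mul_kron (Z : BlockMat F n s s) :
    IsWingPencil (pencilOf (Z * constTranspose (kronLead F n s))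
      (Z * constTranspose (kronConst F n s))) := by
  refine ⟨isPencil_pencilOf _ _, ?_⟩
  rw [← constBlock_mul_pencilOf, Matrix.mul_assoc]
  suffices h : pencilOf (constTranspose (kronLead F n s)) (constTranspose (kronConst F n s)) *
      lambdaCol F n s = 0 by rw [h, Matrix.mul_zero]
  ext1 i j
  rw [Matrix.mul_apply]
  simp only [pencilOf, constTranspose, sub_mul, Finset.sum_sub_distrib]
  rw [Finset.sum_eq_single i.succ, Finset.sum_eq_single i.castSucc]
  · simp only [kronLead, kronConst, if_true, lambdaCol, constPoly_eq, Matrix.transpose_one,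
      map_one, Fin.val_succ, Fin.val_castSucc]
    rw [show s - (i : ℕ) = s - (i + 1) + 1 by have := i.2; omega, pow_succ']
    simp only [mul_smul, Matrix.smul_mul, Matrix.one_mul]
    rw [smul_comm, sub_self]; rfl
  · intro b _ hb
    simp [kronConst, hb, constPoly_eq]
  · simp
  · intro b _ hb
    simp [kronLead, hb, constPoly_eq]
  · simp

end

/-! ### Wing block-columns and block-rows of standard form. -/

theorem stdWing_succ_apply (k i : ℕ) (a : Fin k) :
    stdWing F n k (i + 1) a =
      (X : F[X]) • constPoly (if (a : ℕ) = i + 1 then 1 else 0) -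
        constPoly (if (a : ℕ) = i then 1 else 0) := by
  simp only [stdWing, unitBlocks, Pi.add_apply, Pi.neg_apply, Pi.smul_apply, Nat.add_right_cancel_iff]
  rw [neg_add_eq_sub]
  congr 2 <;> split_ifs <;> simp [constPoly_eq]

theorem transpose_stdWing (k i : ℕ) (a : Fin k) :
    (stdWing F n k i a).transpose = stdWing F n k i a := by
  simp only [stdWing, unitBlocks, Pi.add_apply, Pi.neg_apply, Pi.smul_apply, Matrix.transpose_add,
    Matrix.transpose_neg, Matrix.transpose_smul]
  congr 2 <;> split_ifs <;> simp

theorem stdWingRows_eq {k : ℕ} (N : PolyBlockMat F n k k) (l : Equiv.Perm (Fin k)) (p q : ℕ) :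
    stdWingRows N l p q = stdWingCols (fullTranspose N) l q p := by
  ext c
  simp only [stdWingRows, stdWingCols, Set.mem_ofPred_eq]
  refine and_congr Iff.rfl (exists_congr fun i => and_congr Iff.rfl (and_congr Iff.rfl ?_))
  simp only [funext_iff, fullTranspose]
  refine forall_congr' fun a => ?_
  rw [← transpose_stdWing k i a, Matrix.transpose_inj, transpose_stdWing k i a]

/-! ### Extended block Kronecker pencils from a Fiedler pencil -/

section
variable {k p q : ℕ}

/-- The rows or columns of a block-matrix split into `a + 1` body and `b` wing ones. -/
def splitEquiv {a b k : ℕ} (h : a + 1 + b = k) : Fin (a + 1) ⊕ Fin b ≃ Fin k :=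
  finSumFinEquiv.trans (finCongr h)

theorem splitEquiv_inl {a b k : ℕ} (h : a + 1 + b = k) (i : Fin (a + 1)) :
    (splitEquiv h (.inl i) : ℕ) = i := by simp [splitEquiv]

theorem splitEquiv_inr {a b k : ℕ} (h : a + 1 + b = k) (i : Fin b) :
    (splitEquiv h (.inr i) : ℕ) = a + 1 + i := by simp [splitEquiv]

theorem submatrix_splitEquiv_col (hc : p + 1 + q = k) {U : BlockMat F n k k}
    (hU : ∀ a b : Fin k, (a : ℕ) < p + 1 → U a b = if a = b then 1 else 0) :
    U.submatrix (splitEquiv hc) (splitEquiv hc) = Matrix.fromBlocks 1 0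
      (U.submatrix (splitEquiv hc ∘ .inr) (splitEquiv hc ∘ .inl))
      (U.submatrix (splitEquiv hc ∘ .inr) (splitEquiv hc ∘ .inr)) := by
  ext1 a b
  rcases a with a | a <;> rcases b with b | b
  · rw [Matrix.submatrix_apply, hU _ _ (by rw [splitEquiv_inl]; exact a.2)]
    simp [Matrix.one_apply]
  · rw [Matrix.submatrix_apply, hU _ _ (by rw [splitEquiv_inl]; exact a.2)]
    simp
  · rfl
  · rfl

theorem submatrix_splitEquiv_row (hr : q + 1 + p = k) {U : BlockMat F n k k}
    (hU : ∀ a b : Fin k, (b : ℕ) < q + 1 → U a b = if a = b then 1 else 0) :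
    U.submatrix (splitEquiv hr) (splitEquiv hr) = Matrix.fromBlocks 1
      (U.submatrix (splitEquiv hr ∘ .inl) (splitEquiv hr ∘ .inr)) 0
      (U.submatrix (splitEquiv hr ∘ .inr) (splitEquiv hr ∘ .inr)) := by
  ext1 a b
  rcases a with a | a <;> rcases b with b | b
  · rw [Matrix.submatrix_apply, hU _ _ (by rw [splitEquiv_inl]; exact b.2)]
    simp [Matrix.one_apply]
  · rfl
  · rw [Matrix.submatrix_apply, hU _ _ (by rw [splitEquiv_inl]; exact b.2)]
    simp
  · rfl

/-- The zero block in the corner kills the product of the two off-diagonal factors, so the body only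
gains a multiple of each wing. -/
theorem mul_mul_submatrix_splitEquiv (hr : q + 1 + p = k) (hc : p + 1 + q = k)
    {U₁ U₂ G : BlockMat F n k k} {K : BlockMat F n (q + 1) q} {K' : BlockMat F n p (p + 1)}
    (hU₁ : ∀ a b : Fin k, (b : ℕ) < q + 1 → U₁ a b = if a = b then 1 else 0)
    (hU₂ : ∀ a b : Fin k, (a : ℕ) < p + 1 → U₂ a b = if a = b then 1 else 0)
    (hG : G.submatrix (splitEquiv hr) (splitEquiv hc) = Matrix.fromBlocks
      (G.submatrix (splitEquiv hr ∘ .inl) (splitEquiv hc ∘ .inl)) K K' 0) :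
    (U₁ * G * U₂).submatrix (splitEquiv hr) (splitEquiv hc) = Matrix.fromBlocks
      (G.submatrix (splitEquiv hr ∘ .inl) (splitEquiv hc ∘ .inl) +
        U₁.submatrix (splitEquiv hr ∘ .inl) (splitEquiv hr ∘ .inr) * K' +
        K * U₂.submatrix (splitEquiv hc ∘ .inr) (splitEquiv hc ∘ .inl))
      (K * U₂.submatrix (splitEquiv hc ∘ .inr) (splitEquiv hc ∘ .inr))
      (U₁.submatrix (splitEquiv hr ∘ .inr) (splitEquiv hr ∘ .inr) * K') 0 := by
  rw [← Matrix.submatrix_mul_equiv (U₁ * G) U₂ _ (splitEquiv hc) _,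
    ← Matrix.submatrix_mul_equiv U₁ G _ (splitEquiv hr) _, hG,
    submatrix_splitEquiv_col hc hU₂, submatrix_splitEquiv_row hr hU₁,
    Matrix.fromBlocks_multiply, Matrix.fromBlocks_multiply]
  simp

variable {A : ℕ → Matrix (Fin n) (Fin n) F} {t : List ℕ} {σ τ : Equiv.Perm (Fin k)}
  {D M : BlockMat F n k k}

theorem IsFiedlerForm.lead_submatrix (h : IsFiedlerForm k p q A t σ τ D M)
    (hr : q + 1 + p = k) (hc : p + 1 + q = k) :
    (D.submatrix σ.symm τ.symm).submatrix (splitEquiv hr) (splitEquiv hc) = Matrix.fromBlocks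
      ((D.submatrix σ.symm τ.symm).submatrix (splitEquiv hr ∘ .inl) (splitEquiv hc ∘ .inl))
      (kronLead F n q) (constTranspose (kronLead F n p)) 0 := by
  ext1 a b
  rcases a with a | a <;> rcases b with b | b
  · rfl
  · simp only [Matrix.submatrix_apply, Matrix.fromBlocks_apply₁₂, kronLead]
    rw [h.D_col _ _ (by rw [Equiv.apply_symm_apply, splitEquiv_inr]; omega)]
    simp only [Equiv.apply_symm_apply, splitEquiv_inr, splitEquiv_inl]
    exact if_congr (by rw [Fin.ext_iff, Fin.val_succ]; omega) rfl rfl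
  · simp only [Matrix.submatrix_apply, Matrix.fromBlocks_apply₂₁, kronLead, constTranspose]
    rw [h.D_row _ _ (by rw [Equiv.apply_symm_apply, splitEquiv_inr]; omega)]
    simp only [Equiv.apply_symm_apply, splitEquiv_inr, splitEquiv_inl]
    rw [apply_ite Matrix.transpose, Matrix.transpose_one, Matrix.transpose_zero]
    exact if_congr (by rw [Fin.ext_iff, Fin.val_succ]; omega) rfl rfl
  · simp only [Matrix.submatrix_apply, Matrix.fromBlocks_apply₂₂]
    rw [h.D_row _ _ (by rw [Equiv.apply_symm_apply, splitEquiv_inr]; omega)]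
    simp only [Equiv.apply_symm_apply, splitEquiv_inr]
    rw [if_neg (by omega)]; rfl

theorem IsFiedlerForm.const_submatrix (h : IsFiedlerForm k p q A t σ τ D M)
    (hr : q + 1 + p = k) (hc : p + 1 + q = k) :
    (M.submatrix σ.symm τ.symm).submatrix (splitEquiv hr) (splitEquiv hc) = Matrix.fromBlocks
      ((M.submatrix σ.symm τ.symm).submatrix (splitEquiv hr ∘ .inl) (splitEquiv hc ∘ .inl))
      (kronConst F n q) (constTranspose (kronConst F n p)) 0 := by
  ext1 a b
  rcases a with a | a <;> rcases b with b | b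
  · rfl
  · simp only [Matrix.submatrix_apply, Matrix.fromBlocks_apply₁₂, kronConst]
    rw [h.M_col _ _ (by rw [Equiv.apply_symm_apply, splitEquiv_inr]; omega)]
    simp only [Equiv.apply_symm_apply, splitEquiv_inr, splitEquiv_inl]
    exact if_congr (by rw [Fin.ext_iff, Fin.val_castSucc]; omega) rfl rfl
  · simp only [Matrix.submatrix_apply, Matrix.fromBlocks_apply₂₁, kronConst, constTranspose]
    rw [h.M_row _ _ (by rw [Equiv.apply_symm_apply, splitEquiv_inr]; omega)]
    simp only [Equiv.apply_symm_apply, splitEquiv_inr, splitEquiv_inl]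
    rw [apply_ite Matrix.transpose, Matrix.transpose_one, Matrix.transpose_zero]
    exact if_congr (by rw [Fin.ext_iff, Fin.val_castSucc]; omega) rfl rfl
  · simp only [Matrix.submatrix_apply, Matrix.fromBlocks_apply₂₂]
    rw [h.M_row _ _ (by rw [Equiv.apply_symm_apply, splitEquiv_inr]; omega)]
    simp only [Equiv.apply_symm_apply, splitEquiv_inr]
    rw [if_neg (by omega)]; rfl

theorem IsFiedlerForm.sum_antidiag (h : IsFiedlerForm k p q A t σ τ D M)
    (hr : q + 1 + p = k) (hc : p + 1 + q = k) {s : ℕ} (hs : s ≤ k) :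
    ∑ a : Fin (q + 1), ∑ b : Fin (p + 1),
      ((if (a : ℕ) + b + s = k then
          D (σ.symm (splitEquiv hr (.inl a))) (τ.symm (splitEquiv hc (.inl b))) else 0) -
        (if (a : ℕ) + b + s + 1 = k then
          M (σ.symm (splitEquiv hr (.inl a))) (τ.symm (splitEquiv hc (.inl b))) else 0)) =
      A s := by
  have hp : ∀ x : Fin q, ¬ p + 1 + (x : ℕ) ≤ p := fun x => by omega
  have hq : ∀ x : Fin p, ¬ q + 1 + (x : ℕ) ≤ q := fun x => by omega
  have hp' : ∀ x : Fin (p + 1), (x : ℕ) ≤ p := fun x => by omega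
  have hq' : ∀ x : Fin (q + 1), (x : ℕ) ≤ q := fun x => by omega
  rw [← h.sum_eq s hs, ← Equiv.sum_comp ((splitEquiv hr).trans σ.symm), Fintype.sum_sum_type]
  simp only [← Equiv.sum_comp ((splitEquiv hc).trans τ.symm), Fintype.sum_sum_type]
  simp only [Equiv.trans_apply, Equiv.apply_symm_apply, splitEquiv_inl, splitEquiv_inr, hp, hq,
    hp', hq', and_false, false_and, and_self, if_true, if_false, Finset.sum_const_zero, add_zero]

variable {t₁ t₂ : List ℕ} {l r : Equiv.Perm (Fin k)} {U₁ U₂ : BlockMat F n k k} {g₁ g₂ : Prop}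

theorem IsColumnFactor.constTranspose_row (h : IsColumnFactor (q + 1) t₁ l U₁ g₁) (a b : Fin k)
    (hb : (b : ℕ) < q + 1) : constTranspose U₁ a b = if a = b then 1 else 0 := by
  rw [constTranspose, h.row_lt _ _ hb, apply_ite Matrix.transpose]
  simp [eq_comm]

/-- The wings become constant multiples of Kronecker pencils, and the terms added to the body have
zero antidiagonal sums, so AS is inherited from the Fiedler pencil. -/
theorem IsFiedlerForm.exists_body (h : IsFiedlerForm k p q A t σ τ D M)
    (h₁ : IsColumnFactor (q + 1) t₁ l U₁ g₁) (h₂ : IsColumnFactor (p + 1) t₂ r U₂ g₂) :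
    ∃ B : PolyBlockMat F n (q + 1) (p + 1),
      IsExtendedBlockKronecker p q
        (pencilOf (constTranspose U₁ * D.submatrix σ.symm τ.symm * U₂)
          (constTranspose U₁ * M.submatrix σ.symm τ.symm * U₂)) B ∧
      (∀ s ≤ p + q + 1, antidiagSum B s = A s) ∧
      B 0 0 = (X : F[X]) • constPoly (A k) + constPoly (A (k - 1)) := by
  have hadd := h.add_eq
  have hr : q + 1 + p = k := by omega
  have hc : p + 1 + q = k := by omega
  have hD := mul_mul_submatrix_splitEquiv hr hc h₁.constTranspose_row h₂.row_lt
    (h.lead_submatrix hr hc)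
  have hM := mul_mul_submatrix_splitEquiv hr hc h₁.constTranspose_row h₂.row_lt
    (h.const_submatrix hr hc)
  set T₁ := constTranspose U₁ * D.submatrix σ.symm τ.symm * U₂
  set T₀ := constTranspose U₁ * M.submatrix σ.symm τ.symm * U₂
  set V₁ := (constTranspose U₁).submatrix (splitEquiv hr ∘ .inl) (splitEquiv hr ∘ .inr) with hV₁
  set V₂ := U₂.submatrix (splitEquiv hc ∘ .inr) (splitEquiv hc ∘ .inl) with hV₂
  set Z₁ := (constTranspose U₁).submatrix (splitEquiv hr ∘ .inr) (splitEquiv hr ∘ .inr)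
  set Z₂ := U₂.submatrix (splitEquiv hc ∘ .inr) (splitEquiv hc ∘ .inr)
  refine ⟨pencilOf (T₁.submatrix (splitEquiv hr ∘ .inl) (splitEquiv hc ∘ .inl))
    (T₀.submatrix (splitEquiv hr ∘ .inl) (splitEquiv hc ∘ .inl)), ⟨isPencil_pencilOf _ _, hr, hc,
    pencilOf (Z₁ * constTranspose (kronLead F n p)) (Z₁ * constTranspose (kronConst F n p)),
    pencilOf (constTranspose Z₂ * constTranspose (kronLead F n q))
      (constTranspose Z₂ * constTranspose (kronConst F n q)),
    isWingPencil_mul_kron _, isWingPencil_mul_kron _, ?_⟩, ?_, ?_⟩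
  · rw [assemble, ← constTranspose_mul, ← constTranspose_mul, fullTranspose_pencilOf,
      constTranspose_constTranspose, constTranspose_constTranspose]
    change _ = Matrix.reindex (splitEquiv hr) (splitEquiv hc) _
    rw [← Equiv.symm_apply_eq]
    ext1 a b
    have e₁ := congrFun (congrFun hD a) b
    have e₀ := congrFun (congrFun hM a) b
    simp only [Matrix.reindex_symm, Matrix.reindex_apply, Equiv.symm_symm, Matrix.submatrix_apply,
      pencilOf] at e₁ e₀ ⊢
    rcases a with a | a <;> rcases b with b | b
    · rfl
    · rw [e₁, e₀]; rfl
    · rw [e₁, e₀]; rfl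
    · rw [e₁, e₀]; simp [constPoly_eq]
  · intro s hs
    have key := h.sum_antidiag hr hc (s := s) (by omega)
    have key₁ := sum_antidiag_mul_kron V₁ s k
    have key₂ := sum_antidiag_kron_mul V₂ s k
    refine Eq.trans ?_ ((congrArg₂ (· + ·) (congrArg₂ (· + ·) key key₁) key₂).trans (by simp))
    rw [antidiagSum, ← Finset.sum_add_distrib, ← Finset.sum_add_distrib]
    refine Finset.sum_congr rfl fun a _ => ?_
    rw [← Finset.sum_add_distrib, ← Finset.sum_add_distrib]
    refine Finset.sum_congr rfl fun b _ => ?_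
    have e₁ := congrFun (congrFun hD (.inl a)) (.inl b)
    have e₀ := congrFun (congrFun hM (.inl a)) (.inl b)
    simp only [Matrix.submatrix_apply, Matrix.fromBlocks_apply₁₁, Matrix.add_apply,
      Function.comp_apply] at e₁ e₀
    rw [matCoeff_pencilOf_one, matCoeff_pencilOf_zero, hadd]
    simp only [Matrix.submatrix_apply, Function.comp_apply, e₁, e₀]
    split_ifs <;> abel
  · have e₁ := congrFun (congrFun hD (.inl 0)) (.inl 0)
    have e₀ := congrFun (congrFun hM (.inl 0)) (.inl 0)
    have hl0 : (splitEquiv hr (.inl 0) : ℕ) = 0 := splitEquiv_inl hr 0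
    have hr0 : (splitEquiv hc (.inl 0) : ℕ) = 0 := splitEquiv_inl hc 0
    have hlr : splitEquiv hr (.inl 0) = splitEquiv hc (.inl 0) := Fin.ext (by rw [hl0, hr0])
    have hσ : σ.symm (splitEquiv hc (.inl 0)) = splitEquiv hc (.inl 0) := by
      rw [Equiv.symm_apply_eq, h.row_zero _ hr0]
    have hτ : τ.symm (splitEquiv hc (.inl 0)) = splitEquiv hc (.inl 0) := by
      rw [Equiv.symm_apply_eq, h.col_zero _ hr0]
    -- The first columns of both factors are unit columns, so no correction reaches the corner of
    -- the body.
    have hV₁0 : ∀ K : BlockMat F n p (p + 1), (V₁ * K) 0 0 = 0 := by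
      intro K
      rw [Matrix.mul_apply]
      refine Finset.sum_eq_zero fun i _ => ?_
      rw [hV₁]
      simp only [Matrix.submatrix_apply, Function.comp_apply, constTranspose]
      rw [h₁.col_zero _ _ hl0, if_neg, Matrix.transpose_zero, zero_mul]
      simp
    have hV₂0 : ∀ K : BlockMat F n (q + 1) q, (K * V₂) 0 0 = 0 := by
      intro K
      rw [Matrix.mul_apply]
      refine Finset.sum_eq_zero fun i _ => ?_
      rw [hV₂]
      simp only [Matrix.submatrix_apply, Function.comp_apply]
      rw [h₂.col_zero _ _ hr0, if_neg, mul_zero]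
      simp
    simp only [Matrix.submatrix_apply, Matrix.fromBlocks_apply₁₁, Matrix.add_apply,
      Function.comp_apply, hV₁0, hV₂0, add_zero] at e₁ e₀
    simp only [pencilOf, Matrix.submatrix_apply, Function.comp_apply, e₁, e₀]
    rw [hlr, hσ, hτ, h.D_zero _ hr0, h.M_zero _ hr0, constPoly_eq (-_), map_neg, sub_neg_eq_add,
      ← constPoly_eq]

/-- A wing block-column is the Kronecker pencil applied to the wing part of a column of `U₂`, so it
has standard form exactly when that part is a unit column. -/
theorem IsFiedlerForm.stdWingCols_eq (h : IsFiedlerForm k p q A t σ τ D M)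
    (h₁ : IsColumnFactor (q + 1) t₁ l U₁ g₁) (h₂ : IsColumnFactor (p + 1) t₂ r U₂ g₂)
    (ht : SIP t₂) (hmem : k - 1 ∈ t₂) (hnmem : k ∉ t₂) {N : PolyBlockMat F n k k}
    (hN : N.submatrix id r = pencilOf (constTranspose U₁ * D.submatrix σ.symm τ.symm * U₂)
      (constTranspose U₁ * M.submatrix σ.symm τ.symm * U₂)) :
    nonHeadPositions k t₂ ⊆ stdWingCols N r p q ∧
      (g₂ → stdWingCols N r p q = nonHeadPositions k t₂) := by
  have hadd := h.add_eq
  have hr : q + 1 + p = k := by omega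
  have hc : p + 1 + q = k := by omega
  have hD := mul_mul_submatrix_splitEquiv hr hc h₁.constTranspose_row h₂.row_lt
    (h.lead_submatrix hr hc)
  have hM := mul_mul_submatrix_splitEquiv hr hc h₁.constTranspose_row h₂.row_lt
    (h.const_submatrix hr hc)
  have hnon : ∀ c : Fin k, c ∈ nonHeadPositions k t₂ ↔ ¬ IsHead t₂ (k - 1 - c) := by
    intro c
    simp only [nonHeadPositions, Set.mem_ofPred_eq, ht.heads_eq]
    have hck := c.2
    constructor
    · rintro ⟨j, hj, hh, e⟩
      rwa [show k - 1 - (c : ℕ) = j by omega]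
    · intro hh
      refine ⟨k - 1 - c, ?_, hh, by omega⟩
      -- Otherwise the index is k - 1, the largest one of the tuple, hence a head.
      by_contra hlt
      apply hh
      rw [show k - 1 - (c : ℕ) = k - 1 by omega]
      exact isHead_of_max hmem (by rwa [show k - 1 + 1 = k by omega])
  have hcol : ∀ (a : Fin (q + 1) ⊕ Fin p) (j : Fin q),
      N (splitEquiv hr a) (r (splitEquiv hc (.inr j))) =
      Sum.elim (fun a => pencilOf
        (kronLead F n q * U₂.submatrix (splitEquiv hc ∘ .inr) (splitEquiv hc ∘ .inr))
        (kronConst F n q * U₂.submatrix (splitEquiv hc ∘ .inr) (splitEquiv hc ∘ .inr)) a j)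
        (fun _ => 0) a := by
    intro a j
    have e := congrFun (congrFun hN (splitEquiv hr a)) (splitEquiv hc (.inr j))
    have e₁ := congrFun (congrFun hD a) (.inr j)
    have e₀ := congrFun (congrFun hM a) (.inr j)
    simp only [Matrix.submatrix_apply, id, pencilOf] at e e₁ e₀
    rw [e, e₁, e₀]
    rcases a with a | a
    · rfl
    · simp [constPoly_eq]
  have hwing : ∀ b : Fin k, p + 1 ≤ (b : ℕ) → ∃ j : Fin q, b = splitEquiv hc (.inr j) := by
    intro b hb
    exact ⟨⟨b - (p + 1), by have := b.2; omega⟩, Fin.ext (by rw [splitEquiv_inr]; simp; omega)⟩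
  have hsub : nonHeadPositions k t₂ ⊆ stdWingCols N r p q := by
    intro c hcn
    rw [hnon] at hcn
    obtain ⟨b, rfl⟩ := r.surjective c
    have hb := h₂.le_of_not_isHead b hcn
    refine ⟨by simp [wingCols]; omega, ?_⟩
    obtain ⟨j, rfl⟩ := hwing b hb
    have hU := h₂.col_of_not_isHead _ hcn
    refine ⟨j + 1, by omega, by omega, ?_⟩
    ext1 a
    obtain ⟨a, rfl⟩ := (splitEquiv hr).surjective a
    rw [hcol, stdWing_succ_apply]
    have hU' : ∀ i : Fin q, U₂.submatrix (splitEquiv hc ∘ .inr) (splitEquiv hc ∘ .inr) i j =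
        if i = j then 1 else 0 := fun i => by
      rw [Matrix.submatrix_apply, Function.comp_apply, Function.comp_apply, hU]
      simp
    rcases a with a | a
    · simp only [Sum.elim_inl, pencilOf, Matrix.mul_apply, hU']
      simp only [mul_ite, mul_one, mul_zero, Finset.sum_ite_eq', Finset.mem_univ, if_true,
        kronLead, kronConst]
      simp only [Fin.ext_iff, Fin.val_succ, Fin.val_castSucc, splitEquiv_inl]
    · simp only [Sum.elim_inr, splitEquiv_inr]
      rw [if_neg (by omega), if_neg (by omega)]
      simp [constPoly_eq]
  refine ⟨hsub, fun hg => Set.Subset.antisymm ?_ hsub⟩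
  rintro c ⟨hcw, i, hi1, hiq, he⟩
  rw [hnon]
  intro hh
  obtain ⟨b, rfl⟩ := r.surjective c
  have hb : p + 1 ≤ (b : ℕ) := by simpa [wingCols] using hcw
  obtain ⟨hbb, hor⟩ := h₂.col_of_isHead hg b hb hh
  obtain ⟨j, rfl⟩ := hwing b hb
  obtain ⟨i, rfl⟩ := Nat.exists_eq_add_of_le' hi1
  -- The coefficient of λ, a shifted copy of the column of `U₂`, recovers that column from the wing.
  have hZ : ∀ m : Fin q, U₂ (splitEquiv hc (.inr m)) (splitEquiv hc (.inr j)) =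
      if (m : ℕ) = i then 1 else 0 := by
    intro m
    have e := congrFun he (splitEquiv hr (.inl m.succ))
    rw [hcol, Sum.elim_inl, stdWing_succ_apply, splitEquiv_inl] at e
    have e' := congrArg (fun B => matCoeff B 1) e
    simp only [matCoeff_pencilOf_one, kronLead_mul_succ, Matrix.submatrix_apply,
      Function.comp_apply] at e'
    rw [e']
    -- A 1 × 1 block pencil serves to read off the λ-coefficient of one block of the standard wing.
    have := matCoeff_pencilOf_one (a := 1) (b := 1) (F := F) (n := n)
      (fun _ _ => if ((m.succ : Fin (q + 1)) : ℕ) = i + 1 then 1 else 0)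
      (fun _ _ => if ((m.succ : Fin (q + 1)) : ℕ) = i then 1 else 0) 0 0
    simp only [pencilOf] at this
    rw [this]
    exact if_congr (by simp) rfl rfl
  have hji : (j : ℕ) = i := by
    by_contra hne
    rw [hZ, if_neg hne] at hbb
    exact hbb rfl
  rcases hor with hne | ⟨a, hab, hne⟩
  · rw [hZ, if_pos hji] at hne
    exact hne rfl
  · obtain ⟨a, rfl⟩ := (splitEquiv hc).surjective a
    rcases a with a | a
    · rw [h₂.row_lt _ _ (by rw [splitEquiv_inl]; exact a.2), if_neg hab] at hne
      exact hne rfl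
    · rw [hZ, if_neg] at hne
      · exact hne rfl
      · intro e
        apply hab
        rw [Fin.ext (e.trans hji.symm)]

end

/-! ### Assembly of the Fiedler pencil with its left and right factors. -/

theorem pencil_eq_pencilOf (k : ℕ) (P : MatPoly F n) (lq q rq : List ℕ)
    (𝒳 𝒴 : List (Matrix (Fin n) (Fin n) F)) :
    pencil k P lq q rq 𝒳 𝒴 =
      pencilOf (elementaryProd k lq 𝒳 * leadingDiag k (matCoeff P) * elementaryProd k rq 𝒴)
        (elementaryProd k lq 𝒳 * elementaryProd k q (q.map fun i => -matCoeff P i) *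
          elementaryProd k rq 𝒴) := by
  rw [pencil, ← pencilOf_mul_constBlock, ← constBlock_mul_pencilOf, pencilOf_eq]
  rfl

theorem genericAssignment_transpose_reverse {t : List ℕ} {𝒳 : List (Matrix (Fin n) (Fin n) F)}
    (hlen : 𝒳.length = t.length) (h : GenericAssignment t 𝒳) :
    GenericAssignment t.reverse (𝒳.reverse.map Matrix.transpose) := by
  rintro ⟨i, B⟩ hz
  rw [List.zip_map_right, List.zip_eq_zipWith, ← List.reverse_zipWith hlen.symm,
    ← List.zip_eq_zipWith, List.map_reverse, List.mem_reverse, List.mem_map] at hz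
  obtain ⟨⟨i', B'⟩, hz, e⟩ := hz
  simp only [Prod.map_apply, id, Prod.mk.injEq] at e
  obtain ⟨rfl, rfl⟩ := e
  have := h _ hz
  simpa using this

end

end GFPR

theorem theorem8p2 {F : Type*} [Field F] {n k : ℕ} (hk : 2 ≤ k)
    (P : MatPoly F n) (hP : HasGrade P k)
    (q lq rq : List ℕ)
    (hq : q.Perm (List.range k))
    (hlq : ∀ i ∈ lq, i + 2 ≤ k) (hrq : ∀ i ∈ rq, i + 2 ≤ k)
    (hsip : SIP (lq ++ q ++ rq))
    (𝒳 𝒴 : List (Matrix (Fin n) (Fin n) F))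
    (h𝒳 : 𝒳.length = lq.length) (h𝒴 : 𝒴.length = rq.length) :
    ∃ (l r : Equiv.Perm (Fin k))
      (M : PolyBlockMat F n (headCount q.reverse - 1 + 1) (headCount q - 1 + 1)),
      IsExtendedBlockKronecker (headCount q - 1) (headCount q.reverse - 1)
        ((blockPerm F n l).transpose * pencil k P lq q rq 𝒳 𝒴 * blockPerm F n r) M ∧
      SatisfiesAS P M ∧
      -- (a)
      (∀ i : Fin k, (i : ℕ) = 0 → l i = i ∧ r i = i) ∧
      M 0 0 = (X : F[X]) • constPoly (matCoeff P k) + constPoly (matCoeff P (k - 1)) ∧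
      -- (b)
      nonHeadPositions k (lq ++ q ++ rq) ⊆
        stdWingCols ((blockPerm F n l).transpose * pencil k P lq q rq 𝒳 𝒴) r
          (headCount q - 1) (headCount q.reverse - 1) ∧
      (GenericAssignment rq 𝒴 →
        stdWingCols ((blockPerm F n l).transpose * pencil k P lq q rq 𝒳 𝒴) r
          (headCount q - 1) (headCount q.reverse - 1) =
        nonHeadPositions k (lq ++ q ++ rq)) ∧
      (∀ j : ℕ, j + 2 ≤ k →
        (j ∉ heads (lq ++ q ++ rq) ↔ SIP (lq ++ q ++ rq ++ [j]))) ∧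
      -- (c)
      nonHeadPositions k (rq.reverse ++ q.reverse ++ lq.reverse) ⊆
        stdWingRows (pencil k P lq q rq 𝒳 𝒴 * blockPerm F n r) l
          (headCount q - 1) (headCount q.reverse - 1) ∧
      (GenericAssignment lq 𝒳 →
        stdWingRows (pencil k P lq q rq 𝒳 𝒴 * blockPerm F n r) l
          (headCount q - 1) (headCount q.reverse - 1) =
        nonHeadPositions k (rq.reverse ++ q.reverse ++ lq.reverse)) ∧
      (∀ j : ℕ, j + 2 ≤ k →
        (j ∉ heads (rq.reverse ++ q.reverse ++ lq.reverse) ↔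
          SIP (rq.reverse ++ q.reverse ++ lq.reverse ++ [j]))) := by
  have hsip' : SIP (rq.reverse ++ q.reverse ++ lq.reverse) := by
    have := hsip.reverse
    simpa using this
  have hmem : ∀ i, i ∈ q ↔ i < k := fun i => by rw [hq.mem_iff, List.mem_range]
  have hsq : SIP q := hsip.of_append
  have hsr : SIP (q ++ rq) := SIP.of_append (u := lq) (w := []) (by simpa using hsip)
  have hsl : SIP (q.reverse ++ lq.reverse) :=
    SIP.of_append (u := rq.reverse) (w := []) (by simpa using hsip')
  have hrl : ∀ i ∈ lq.reverse, i + 2 ≤ k := fun i hi => hlq i (by simpa using hi)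
  obtain ⟨p', q', σ, τ, hF⟩ : ∃ p q' σ τ, IsFiedlerForm k p q' (matCoeff P) q σ τ
      (leadingDiag k (matCoeff P)) (elementaryProd k q (q.map fun i => -matCoeff P i)) := by
    obtain ⟨m, rfl⟩ := Nat.exists_eq_add_of_le' (show 1 ≤ k by omega)
    exact exists_isFiedlerForm m q hq (matCoeff P)
  have hadd := hF.add_eq
  have hp : headCount q = p' + 1 := hF.headCount_eq hsq fun i hi => (hmem i).1 hi
  have hq' : headCount q.reverse = q' + 1 :=
    hF.transpose.headCount_eq hsq.reverse fun i hi => (hmem i).1 (by simpa using hi)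
  obtain ⟨r, hr⟩ := exists_isColumnFactor (m := p' + 1) (Nat.succ_pos _) τ.symm
    (fun i hi => by rw [Equiv.symm_apply_eq, hF.col_zero i hi])
    (fun b => by rw [← hF.col_wing, Equiv.apply_symm_apply]) rq hrq hsr 𝒴 h𝒴
  obtain ⟨l, hl⟩ := exists_isColumnFactor (m := q' + 1) (Nat.succ_pos _) σ.symm
    (fun i hi => by rw [Equiv.symm_apply_eq, hF.row_zero i hi])
    (fun b => by rw [← hF.row_wing, Equiv.apply_symm_apply]) lq.reverse hrl hsl
    (𝒳.reverse.map Matrix.transpose) (by simpa using h𝒳)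
  rw [← constTranspose_elementaryProd k lq 𝒳 h𝒳] at hl
  have hcl : ∀ B : BlockMat F n k k,
      constTranspose ((constTranspose B).submatrix σ.symm l) = B.submatrix l σ.symm := by
    intro B
    ext1 i j
    simp [constTranspose]
  -- The inner permutations, which put the Fiedler pencil in Kronecker form, cancel between
  -- neighbouring factors.
  have hprod : ∀ U G V : BlockMat F n k k, U.submatrix l σ.symm * G.submatrix σ.symm τ.symm *
      V.submatrix τ.symm r = (U * G * V).submatrix l r := by
    intro U G V
    rw [Matrix.submatrix_mul_equiv, Matrix.submatrix_mul_equiv]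
  obtain ⟨B, hB, hAS, hB0⟩ := hF.exists_body hl hr
  have hcol := hF.stdWingCols_eq (N := (blockPerm F n l).transpose * pencil k P lq q rq 𝒳 𝒴) hl hr
    hsr (by simp [hmem]; omega)
    (by simp only [List.mem_append, hmem]; rintro (h | h); omega; have := hrq k h; omega)
    (by rw [hcl, hprod, hprod, transpose_blockPerm_mul, pencil_eq_pencilOf]; rfl)
  -- The rows are the columns of the transposed pencil, in which the two factors exchange roles.
  have hrow := hF.transpose.stdWingCols_eq
    (N := fullTranspose (pencil k P lq q rq 𝒳 𝒴 * blockPerm F n r)) hr hl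
    hsl (by simp [hmem]; omega)
    (by
      simp only [List.mem_append, List.mem_reverse, hmem]
      rintro (h | h); omega; have := hlq k h; omega)
    (by
      have key : ∀ G : BlockMat F n k k,
          constTranspose ((elementaryProd k rq 𝒴).submatrix τ.symm r) *
            (constTranspose G).submatrix τ.symm σ.symm *
            (constTranspose (elementaryProd k lq 𝒳)).submatrix σ.symm l =
          constTranspose ((elementaryProd k lq 𝒳 * G * elementaryProd k rq 𝒴).submatrix l r) := by
        intro G
        rw [← hprod, constTranspose_mul, constTranspose_mul, Matrix.mul_assoc]
        rfl
      rw [key, key, ← fullTranspose_pencilOf, mul_blockPerm, pencil_eq_pencilOf]; rfl)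
  -- The middle tuple contains every index, so whatever precedes it has no influence on the heads.
  have hheads : ∀ {u v w : List ℕ}, (∀ i ∈ w, i + 2 ≤ k) → (∀ i, i ∈ v ↔ i < k) →
      SIP (u ++ v ++ w) → SIP (v ++ w) →
      nonHeadPositions k (u ++ v ++ w) = nonHeadPositions k (v ++ w) := by
    intro u v w hw hv h1 h2
    ext c
    simp only [nonHeadPositions, h1.heads_eq, h2.heads_eq, Set.mem_ofPred_eq]
    refine exists_congr fun j => and_congr_right fun hj => and_congr_left fun _ => ?_
    rw [List.append_assoc, isHead_append_of_mem (by simp [hv]; omega)]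
  rw [hheads hrq hmem hsip hsr, hheads hrl (by simp [hmem]) hsip' hsl]
  -- Both head counts are positive, so the truncated subtraction loses nothing.
  obtain rfl : p' = headCount q - 1 := by omega
  obtain rfl : q' = headCount q.reverse - 1 := by omega
  rw [hcl, hprod, hprod] at hB
  refine ⟨l, r, B, ?_, hAS, fun i hi => ⟨hl.perm_zero i hi, hr.perm_zero i hi⟩, hB0, hcol.1,
    hcol.2, ?_, ?_, ?_, ?_⟩
  · rw [transpose_blockPerm_mul, mul_blockPerm, pencil_eq_pencilOf]
    exact hB
  · intro j _
    rw [hsip.heads_eq]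
    exact hsip.append_singleton_iff j
  · rw [stdWingRows_eq]
    exact hrow.1
  · rw [stdWingRows_eq]
    exact fun h => hrow.2 (genericAssignment_transpose_reverse h𝒳 h)
  · intro j _
    rw [hsip'.heads_eq]
    exact hsip'.append_singleton_iff j
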